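/- Fix $T>0$ and integers $n,m\ge 1$. Let $\varphi:\mathbb R^n\to(-\infty,\infty]$ and $\psi:\mathbb R^m\to(-\infty,\infty]$ be convex, lower semicontinuous and not identically $+\infty$. For such a function $F$ on $\mathbb R^q$, let $$\partial F(x)=\{\xi\in\mathbb R^q:\ \langle \xi,y-x\rangle+F(x)\le F(y)\ \text{ for all } y\in\mathbb R^q\}\ \text{ if } F(x)<\infty,\qquad \partial F(x)=\emptyset\ \text{ if } F(x)=\infty,$$ and let $F_p(x)=\inf_{y\in\mathbb R^q}\{F(y)+\tfrac p2\|x-y\|^2\}$, $p\in\{1,2,\dots\}$, be its Moreau--Yosida regularizations (which are real-valued and differentiable). Let $f\in C([0,T];\mathbb R^n)$, let $b^x:\mathbb R^n\times\mathbb R^m\to\mathbb R^n$ and $b^z:\mathbb R^n\times\mathbb R^m\to\mathbb R^m$ be Lipschitz, and let $x_0\in\mathbb R^n$, $z_0\in\mathbb R^m$. Assume that $$\sup_{p\ge 1}\ \sup_{x\in\mathbb R^n}\|\nabla\varphi_p(x)\|<\infty\qquad\text{and}\qquad \sup_{p\ge1}\psi_p(z_0)<\infty .$$ By a solution on $[0,T]$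 of the differential inclusion $$x'(t)+\partial\varphi(x(t))\ni b^x(x(t),z(t))+f(t),\qquad z'(t)+\partial\psi(z(t))\ni b^z(x(t),z(t)),\qquad (x(0),z(0))=(x_0,z_0), \tag{1}$$ we mean a pair of absolutely continuous functions $x:[0,T]\to\mathbb R^n$, $z:[0,T]\to\mathbb R^m$ with these initial values such that $x$ and $z$ are differentiable and satisfy both inclusions at almost every $t\in(0,T)$. Then: 1. (Existence) The inclusion (1) has a solution $(x,z)\in C([0,T];\mathbb R^n\times\mathbb R^m)$, with $x',z'\in L^2(0,T)$. 2. (Uniqueness) Any two solutions of (1) coincide on $[0,T]$. 3. (Penalization) For every integer $p\ge1$ the penalized system $$(x^p)'+\nabla\varphi_p(x^p)=b^x(x^p,z^p)+f,\qquad (z^p)'+\nabla\psi_p(z^p)=b^z(x^p,z^p),\qquad (x^p(0),z^p(0))=(x_0,z_0)$$ has exactly one classical solution $(x^p,z^p)$ on $[0,T]$, and $(x^p,z^p)\to(x,z)$ uniformly on $[0,T]$ as $p\to\infty$. -/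

import Mathlib

open Set Filter Topology MeasureTheory

namespace MultivaluedODE

/-- The Euclidean space of dimension `q`. -/
abbrev E (q : ℕ) : Type := EuclideanSpace ℝ (Fin q)

/-- `F` takes its values in `(-∞, ∞]`, is not identically `∞`, is convex (its epigraph is convex)
and is lower semicontinuous. -/
structure IsProperConvexLSC {q : ℕ} (F : E q → EReal) : Prop where
  ne_bot : ∀ x, F x ≠ ⊥
  dom_nonempty : ∃ x, F x < ⊤
  convex_epigraph : Convex ℝ {y : E q × ℝ | F y.1 ≤ (y.2 : EReal)}
  lsc : LowerSemicontinuous F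

/-- The subdifferential `∂F(x)`; it is empty where `F x = ∞`. -/
def subdifferential {q : ℕ} (F : E q → EReal) (x : E q) : Set (E q) :=
  {ξ | F x < ⊤ ∧ ∀ z : E q, ((inner ℝ ξ (z - x) : ℝ) : EReal) + F x ≤ F z}

/-- The Moreau-Yosida regularization
`F_p(x) = inf_z (F z + (p / 2) ‖x - z‖ ^ 2)`. -/
noncomputable def moreauYosida {q : ℕ} (F : E q → EReal) (p : ℕ) (x : E q) : EReal :=
  ⨅ z : E q, F z + (((p : ℝ) / 2 * ‖x - z‖ ^ 2 : ℝ) : EReal)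

/-- The gradient `∇F_p(x)`. For `p ≥ 1` and `F` proper, convex and lower semicontinuous, `F_p` is
real-valued and differentiable, so neither `toReal` nor `gradient` takes a default value. -/
noncomputable def gradMoreauYosida {q : ℕ} (F : E q → EReal) (p : ℕ) (x : E q) : E q :=
  gradient (fun y => (moreauYosida F p y).toReal) x

/-- The condition `sup_{p ≥ 1} sup_x ‖∇F_p(x)‖ < ∞`. -/
def UniformGradientBound {q : ℕ} (F : E q → EReal) : Prop :=
  ∃ C : ℝ, ∀ p : ℕ, 1 ≤ p → ∀ x : E q, ‖gradMoreauYosida F p x‖ ≤ C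

/-- `(x, z)` is a solution on `[0, T]` of the coupled differential inclusion
`x' + ∂φ(x) ∋ bx(x, z) + f`, `z' + ∂ψ(z) ∋ bz(x, z)`, `(x, z)(0) = (x₀, z₀)`:
both components are absolutely continuous (hence continuous) on `[0, T]` and the inclusions hold
at almost every time. -/
structure IsSolution {n m : ℕ} (φ : E n → EReal) (ψ : E m → EReal)
    (bx : E n × E m → E n) (bz : E n × E m → E m) (f : ℝ → E n) (x₀ : E n) (z₀ : E m) (T : ℝ)
    (x : ℝ → E n) (z : ℝ → E m) : Prop where
  absCont_x : AbsolutelyContinuousOnInterval x 0 T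
  absCont_z : AbsolutelyContinuousOnInterval z 0 T
  init_x : x 0 = x₀
  init_z : z 0 = z₀
  incl_x : ∀ᵐ t : ℝ, t ∈ Ioo 0 T →
    DifferentiableAt ℝ x t ∧ bx (x t, z t) + f t - deriv x t ∈ subdifferential φ (x t)
  incl_z : ∀ᵐ t : ℝ, t ∈ Ioo 0 T →
    DifferentiableAt ℝ z t ∧ bz (x t, z t) - deriv z t ∈ subdifferential ψ (z t)

/-- `(x, z)` is a classical solution on `[0, T]` of the penalized system
`x' + ∇φ_p(x) = bx(x, z) + f`, `z' + ∇ψ_p(z) = bz(x, z)`, `(x, z)(0) = (x₀, z₀)`. -/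
structure IsPenalizedSolution {n m : ℕ} (φ : E n → EReal) (ψ : E m → EReal)
    (bx : E n × E m → E n) (bz : E n × E m → E m) (f : ℝ → E n) (x₀ : E n) (z₀ : E m) (T : ℝ)
    (p : ℕ) (x : ℝ → E n) (z : ℝ → E m) : Prop where
  init_x : x 0 = x₀
  init_z : z 0 = z₀
  eq_x : ∀ t ∈ Icc 0 T,
    HasDerivWithinAt x (bx (x t, z t) + f t - gradMoreauYosida φ p (x t)) (Icc 0 T) t
  eq_z : ∀ t ∈ Icc 0 T,
    HasDerivWithinAt z (bz (x t, z t) - gradMoreauYosida ψ p (z t)) (Icc 0 T) t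

end MultivaluedODE

/-! On the ℓ² product of the two spaces the system is a single inclusion `u' + A u ∋ b(t, u)`, with
`A` maximal monotone and `b` Lipschitz in `u`. Monotonicity gives `(‖u - v‖²)' ≤ 2K‖u - v‖²` for any
two solutions, hence uniqueness, both for the inclusion and for each penalized equation.

For existence, the gradient `a_p` of the regularization `Φ_p` is the Yosida approximation of `A`: it
is `p`-Lipschitz, and `a_p x` lies in `A` at the proximal point `x - a_p x / p`. The penalized
equation is therefore a Lipschitz ODE. Testing it with `a_p(u_p) = ∇Φ_p(u_p)` controls the squared
norms of `a_p(u_p)` and `u_p'` in mean by the drop of `Φ_p` along the curve (`exists_energy_bound`).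
This is uniform in `p` once `Φ_p(u₀)` is bounded above. For `ψ` that is assumed; for `φ` the
gradient bound yields it by comparison with a point where `φ` is finite.

Monotonicity tested at the proximal points then gives `‖u_p - u_q‖² = O(1/p + 1/q)`
(`norm_sub_sq_le`), so `u_p` converges uniformly. The energy bound makes the limit absolutely
continuous with `u' ∈ L²`. The inequality obtained by testing with an arbitrary `(y, η)` in the
graph of `A`, integrated over a short interval, survives the limit; dividing by the length of the
interval and invoking maximality (`mem_of_forall`) gives the inclusion
(`sub_deriv_mem_of_tendstoUniformlyOn`). No weak convergence of derivatives is needed.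

Energy integrals are represented by primitives `V`: `V'` dominates the squared norms, so `V` is
monotone, and its total increment is bounded in `p`. -/

namespace MultivaluedODE

/-! ### Convex analysis: proximal points and Moreau-Yosida regularizations. -/

/-- A function lying between its tangent at `x` and a paraboloid touching it at `x` is
differentiable at `x`. -/
theorem hasGradientAt_of_add_inner_le {H : Type*} [NormedAddCommGroup H] [InnerProductSpace ℝ H]
    [CompleteSpace H] {Φ : H → ℝ} {x ξ : H} {c : ℝ}
    (h₁ : ∀ y, Φ x + inner ℝ ξ (y - x) ≤ Φ y)
    (h₂ : ∀ y, Φ y ≤ Φ x + inner ℝ ξ (y - x) + c / 2 * ‖y - x‖ ^ 2) : HasGradientAt Φ ξ x := by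
  rw [hasGradientAt_iff_isLittleO]
  refine Asymptotics.IsBigO.trans_isLittleO (g := fun y => ‖y - x‖ ^ 2) ?_
    (Asymptotics.isLittleO_pow_sub_sub x one_lt_two)
  refine Asymptotics.IsBigO.of_bound (c / 2) (Eventually.of_forall fun y => ?_)
  rw [Real.norm_eq_abs, Real.norm_of_nonneg (by positivity), abs_le]
  constructor <;> linarith [h₁ y, h₂ y]

namespace IsProperConvexLSC

variable {q : ℕ} {F : E q → EReal}

theorem le_combination (hF : IsProperConvexLSC F) {x y : E q} {a b s : ℝ}
    (hx : F x ≤ a) (hy : F y ≤ b) (hs₀ : 0 ≤ s) (hs₁ : s ≤ 1) :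
    F ((1 - s) • x + s • y) ≤ ((1 - s) * a + s * b : ℝ) := by
  have h := hF.convex_epigraph (x := (x, a)) hx (y := (y, b)) hy
    (sub_nonneg.2 hs₁) hs₀ (by ring)
  simpa using h

theorem exists_eq_coe (hF : IsProperConvexLSC F) {x : E q} (hx : F x < ⊤) :
    ∃ a : ℝ, F x = a :=
  ⟨(F x).toReal, (EReal.coe_toReal hx.ne (hF.ne_bot x)).symm⟩

/-- A proper convex lower semicontinuous function grows at least like a negative multiple of the
norm. -/
theorem exists_linear_lower_bound (hF : IsProperConvexLSC F) :
    ∃ (c : ℝ) (y₀ : E q), 0 ≤ c ∧ F y₀ < ⊤ ∧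
      ∀ z, ((-(c * (1 + ‖z - y₀‖)) : ℝ) : EReal) ≤ F z := by
  obtain ⟨y₀, hy₀⟩ := hF.dom_nonempty
  obtain ⟨α, hα⟩ := hF.exists_eq_coe hy₀
  obtain ⟨w, -, hw⟩ := LowerSemicontinuousOn.exists_isMinOn
    (⟨y₀, Metric.mem_closedBall_self zero_le_one⟩ : (Metric.closedBall y₀ 1).Nonempty)
    (isCompact_closedBall y₀ 1) (hF.lsc.lowerSemicontinuousOn _)
  have hw' : ∀ z, ‖z - y₀‖ ≤ 1 → F w ≤ F z := fun z hz =>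
    hw (by simpa [dist_eq_norm] using hz)
  obtain ⟨m, hm⟩ := hF.exists_eq_coe ((hw' y₀ (by simp)).trans_lt hy₀)
  refine ⟨|m| + |α|, y₀, by positivity, hy₀, fun z => ?_⟩
  rcases eq_or_ne (F z) ⊤ with hz | hz
  · rw [hz]; exact le_top
  obtain ⟨β, hβ⟩ := hF.exists_eq_coe (lt_top_iff_ne_top.2 hz)
  rw [hβ, EReal.coe_le_coe_iff]
  have h1 := neg_abs_le m
  have h2 := neg_abs_le α
  have h3 := le_abs_self α
  have h4 := norm_nonneg (z - y₀)
  rcases le_or_gt ‖z - y₀‖ 1 with hr | hr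
  · have := hw' z hr
    rw [hm, hβ, EReal.coe_le_coe_iff] at this
    nlinarith [abs_nonneg m, abs_nonneg α, mul_nonneg (abs_nonneg m) h4,
      mul_nonneg (abs_nonneg α) h4]
  · set r := ‖z - y₀‖ with hrdef
    have hr0 : 0 < r := by linarith
    -- The point of the segment from `y₀` to `z` at distance 1 from `y₀` has value at least `m`;
    -- convexity turns this into `F z ≥ r m - (r - 1) α`.
    have h5 := hF.le_combination (s := r⁻¹) hα.le hβ.le (by positivity) (inv_le_one_of_one_le₀ hr.le)
    have h6 := hw' ((1 - r⁻¹) • y₀ + r⁻¹ • z) (by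
      have : (1 - r⁻¹) • y₀ + r⁻¹ • z - y₀ = r⁻¹ • (z - y₀) := by module
      rw [this, norm_smul, ← hrdef, Real.norm_of_nonneg (by positivity), inv_mul_cancel₀ hr0.ne'])
    have h7 := h6.trans h5
    rw [hm, EReal.coe_le_coe_iff] at h7
    have h8 : r * m ≤ (r - 1) * α + β := by
      calc r * m ≤ r * ((1 - r⁻¹) * α + r⁻¹ * β) := by gcongr
        _ = (r - 1) * α + β := by field_simp
    nlinarith [abs_nonneg m, abs_nonneg α]

/-- The quadratic beats the at most linear decay of `F`, so the search can be confined to a compact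
ball, where lower semicontinuity suffices. -/
theorem exists_minimizer (hF : IsProperConvexLSC F) {p : ℕ} (hp : 1 ≤ p) (x : E q) :
    ∃ w, F w < ⊤ ∧ ∀ z, F w + (((p : ℝ) / 2 * ‖x - w‖ ^ 2 : ℝ) : EReal) ≤
      F z + (((p : ℝ) / 2 * ‖x - z‖ ^ 2 : ℝ) : EReal) := by
  obtain ⟨c, y₀, hc, hy₀, hlow⟩ := hF.exists_linear_lower_bound
  obtain ⟨α, hα⟩ := hF.exists_eq_coe hy₀
  have hp' : (1 : ℝ) ≤ p := by exact_mod_cast hp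
  set G : E q → EReal := fun z => F z + (((p : ℝ) / 2 * ‖x - z‖ ^ 2 : ℝ) : EReal) with hG
  have hGlsc : LowerSemicontinuous G := by
    refine hF.lsc.add' (Continuous.lowerSemicontinuous ?_) fun z => ?_
    · exact continuous_coe_real_ereal.comp (by fun_prop)
    · exact EReal.continuousAt_add (Or.inr (EReal.coe_ne_bot _)) (Or.inr (EReal.coe_ne_top _))
  set d := ‖x - y₀‖ with hd
  set α' := α + (p : ℝ) / 2 * d ^ 2 with hα'
  have hGy₀ : G y₀ = α' := by simp only [hG, hα, hα', ← hd, EReal.coe_add]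
  -- Outside this ball `s = ‖x - z‖` exceeds `2c + 2`, so `s²/2 - cs ≥ s`, and it also exceeds `|α'|
  -- + c(1 + d)`; together these push the objective above its value `α'` at `y₀`.
  set ρ := d + (2 * c + 2 + |α'| + c * (1 + d)) with hρ
  have hd0 : 0 ≤ d := norm_nonneg _
  have hρ0 : 0 ≤ ρ := by positivity
  obtain ⟨w, -, hw⟩ := LowerSemicontinuousOn.exists_isMinOn
    (⟨y₀, Metric.mem_closedBall_self hρ0⟩ : (Metric.closedBall y₀ ρ).Nonempty)
    (isCompact_closedBall y₀ ρ) (hGlsc.lowerSemicontinuousOn _)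
  have hw₀ : G w ≤ α' := hGy₀ ▸ hw (Metric.mem_closedBall_self hρ0)
  refine ⟨w, ?_, fun z => ?_⟩
  · by_contra h
    rw [not_lt_top_iff] at h
    simp only [hG, h, EReal.top_add_coe] at hw₀
    exact (EReal.coe_lt_top α').not_ge hw₀
  · rcases le_or_gt ‖z - y₀‖ ρ with hz | hz
    · exact hw (by simpa [dist_eq_norm] using hz)
    · refine hw₀.trans ?_
      calc (α' : EReal) ≤ ((-(c * (1 + ‖z - y₀‖)) : ℝ) : EReal) +
            (((p : ℝ) / 2 * ‖x - z‖ ^ 2 : ℝ) : EReal) := ?_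
        _ ≤ _ := by gcongr; exact hlow z
      rw [← EReal.coe_add, EReal.coe_le_coe_iff]
      have h1 : ‖z - y₀‖ ≤ ‖x - z‖ + d := by
        have := norm_sub_le_norm_sub_add_norm_sub z x y₀
        rwa [norm_sub_rev z x] at this
      set s := ‖x - z‖
      have h2 : 2 * c + 2 + |α'| + c * (1 + d) ≤ s := by linarith
      have h3 : s ^ 2 / 2 ≤ (p : ℝ) / 2 * s ^ 2 := by nlinarith [sq_nonneg s]
      have h4 : c * (1 + ‖z - y₀‖) ≤ c * (1 + d) + c * s := by nlinarith
      have h5 : s ≤ s ^ 2 / 2 - c * s := by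
        nlinarith [abs_nonneg α', mul_nonneg hc (by positivity : (0 : ℝ) ≤ 1 + d)]
      have h6 : 0 ≤ c * s := mul_nonneg hc (norm_nonneg _)
      linarith [le_abs_self α']

end IsProperConvexLSC

/-- The proximal point `J_p x`, at which the infimum defining `F_p x` is attained. -/
noncomputable def prox {q : ℕ} (F : E q → EReal) (p : ℕ) (x : E q) : E q :=
  Classical.epsilon fun w => F w < ⊤ ∧ ∀ z, F w + (((p : ℝ) / 2 * ‖x - w‖ ^ 2 : ℝ) : EReal) ≤
      F z + (((p : ℝ) / 2 * ‖x - z‖ ^ 2 : ℝ) : EReal)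

/-- The Yosida approximation `p (x - J_p x)` of the subdifferential. -/
noncomputable def yosida {q : ℕ} (F : E q → EReal) (p : ℕ) (x : E q) : E q :=
  (p : ℝ) • (x - prox F p x)

theorem subdifferential_monotone {q : ℕ} {F : E q → EReal} {x y ξ η : E q} (hbot : ∀ x, F x ≠ ⊥)
    (hξ : ξ ∈ subdifferential F x) (hη : η ∈ subdifferential F y) :
    0 ≤ inner ℝ (ξ - η) (x - y) := by
  obtain ⟨hx, h1⟩ := hξ
  obtain ⟨hy, h2⟩ := hη
  have h1 := h1 y
  have h2 := h2 x
  rw [← EReal.coe_toReal hx.ne (hbot x), ← EReal.coe_toReal hy.ne (hbot y), ← EReal.coe_add,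
    EReal.coe_le_coe_iff] at h1 h2
  have h3 : inner ℝ ξ (y - x) = -inner ℝ ξ (x - y) := by rw [← inner_neg_right, neg_sub]
  rw [inner_sub_left]
  linarith

namespace IsProperConvexLSC

variable {q : ℕ} {F : E q → EReal} {p : ℕ}

theorem prox_lt_top (hF : IsProperConvexLSC F) (hp : 1 ≤ p) (x : E q) : F (prox F p x) < ⊤ :=
  (Classical.epsilon_spec (hF.exists_minimizer hp x)).1

theorem prox_le (hF : IsProperConvexLSC F) (hp : 1 ≤ p) (x z : E q) :
    F (prox F p x) + (((p : ℝ) / 2 * ‖x - prox F p x‖ ^ 2 : ℝ) : EReal) ≤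
      F z + (((p : ℝ) / 2 * ‖x - z‖ ^ 2 : ℝ) : EReal) :=
  (Classical.epsilon_spec (hF.exists_minimizer hp x)).2 z

theorem coe_toReal_prox (hF : IsProperConvexLSC F) (hp : 1 ≤ p) (x : E q) :
    ((F (prox F p x)).toReal : EReal) = F (prox F p x) :=
  EReal.coe_toReal (hF.prox_lt_top hp x).ne (hF.ne_bot _)

theorem moreauYosida_eq (hF : IsProperConvexLSC F) (hp : 1 ≤ p) (x : E q) :
    moreauYosida F p x =
      (((F (prox F p x)).toReal + (p : ℝ) / 2 * ‖x - prox F p x‖ ^ 2 : ℝ) : EReal) := by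
  rw [EReal.coe_add, hF.coe_toReal_prox hp]
  exact le_antisymm (iInf_le _ _) (le_iInf fun z => hF.prox_le hp x z)

theorem toReal_moreauYosida (hF : IsProperConvexLSC F) (hp : 1 ≤ p) (x : E q) :
    (moreauYosida F p x).toReal =
      (F (prox F p x)).toReal + (p : ℝ) / 2 * ‖x - prox F p x‖ ^ 2 := by
  rw [hF.moreauYosida_eq hp, EReal.toReal_coe]

theorem coe_toReal_moreauYosida (hF : IsProperConvexLSC F) (hp : 1 ≤ p) (x : E q) :
    ((moreauYosida F p x).toReal : EReal) = moreauYosida F p x := by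
  rw [hF.moreauYosida_eq hp, EReal.toReal_coe]

/-- First-order optimality of the proximal point `w`: compare it with `(1 - s) w + s y`, divide by
`s` and let `s → 0⁺`. -/
theorem yosida_mem_subdifferential (hF : IsProperConvexLSC F) (hp : 1 ≤ p) (x : E q) :
    yosida F p x ∈ subdifferential F (prox F p x) := by
  refine ⟨hF.prox_lt_top hp x, fun y => ?_⟩
  rcases eq_or_ne (F y) ⊤ with hy | hy
  · rw [hy]; exact le_top
  obtain ⟨β, hβ⟩ := hF.exists_eq_coe (lt_top_iff_ne_top.2 hy)
  obtain ⟨α, hα⟩ := hF.exists_eq_coe (hF.prox_lt_top hp x)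
  rw [hα, hβ, ← EReal.coe_add, EReal.coe_le_coe_iff]
  have hmin := hF.prox_le hp x
  rw [hα] at hmin
  unfold yosida
  set w := prox F p x
  have key : ∀ s : ℝ, 0 < s → s ≤ 1 →
      inner ℝ ((p : ℝ) • (x - w)) (y - w) + α ≤ β + s * ((p : ℝ) / 2 * ‖y - w‖ ^ 2) := by
    intro s hs₀ hs₁
    have h1 := (hmin ((1 - s) • w + s • y)).trans
      (add_le_add_left (hF.le_combination hα.le hβ.le hs₀.le hs₁) _)
    rw [← EReal.coe_add, ← EReal.coe_add, EReal.coe_le_coe_iff] at h1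
    have h2 : x - ((1 - s) • w + s • y) = (x - w) - s • (y - w) := by module
    rw [h2, norm_sub_sq_real (x - w) (s • (y - w)), inner_smul_right, norm_smul, Real.norm_of_nonneg hs₀.le] at h1
    rw [inner_smul_left, RCLike.conj_to_real]
    have h3 : s * ((p : ℝ) * inner ℝ (x - w) (y - w) + α) ≤
        s * (β + s * ((p : ℝ) / 2 * ‖y - w‖ ^ 2)) := by nlinarith
    exact le_of_mul_le_mul_left h3 hs₀
  have hlim : Tendsto (fun s : ℝ => β + s * ((p : ℝ) / 2 * ‖y - w‖ ^ 2)) (𝓝[>] 0) (𝓝 β) := by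
    have : Continuous fun s : ℝ => β + s * ((p : ℝ) / 2 * ‖y - w‖ ^ 2) := by fun_prop
    simpa using (this.tendsto 0).mono_left nhdsWithin_le_nhds
  refine ge_of_tendsto hlim ?_
  filter_upwards [Ioc_mem_nhdsGT zero_lt_one] with s hs using key s hs.1 hs.2

theorem prox_eq_sub (hp : 1 ≤ p) (x : E q) :
    prox F p x = x - (p : ℝ)⁻¹ • yosida F p x := by
  have hp' : (p : ℝ) ≠ 0 := by positivity
  rw [yosida, smul_smul, inv_mul_cancel₀ hp', one_smul, sub_sub_cancel]

/-- Moreau-Yosida regularizations lie above their tangents. -/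
theorem moreauYosida_add_inner_le (hF : IsProperConvexLSC F) (hp : 1 ≤ p) (x y : E q) :
    (moreauYosida F p x).toReal + inner ℝ (yosida F p x) (y - x) ≤
      (moreauYosida F p y).toReal := by
  rw [hF.toReal_moreauYosida hp, hF.toReal_moreauYosida hp]
  have h1 := (hF.yosida_mem_subdifferential hp x).2 (prox F p y)
  rw [← hF.coe_toReal_prox hp x, ← hF.coe_toReal_prox hp y, ← EReal.coe_add,
    EReal.coe_le_coe_iff] at h1
  have hp' : (0 : ℝ) ≤ p := by positivity
  have h2 : inner ℝ (yosida F p x) (y - x) = inner ℝ (yosida F p x) (prox F p y - prox F p x)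
      + p * (inner ℝ (x - prox F p x) (y - prox F p y) - ‖x - prox F p x‖ ^ 2) := by
    have : y - x = (prox F p y - prox F p x) + ((y - prox F p y) - (x - prox F p x)) := by abel
    rw [this, inner_add_right, inner_sub_right (yosida F p x) (y - prox F p y)]
    simp only [yosida, inner_smul_left, RCLike.conj_to_real, real_inner_self_eq_norm_sq]
    ring
  have h3 := norm_sub_sq_real (x - prox F p x) (y - prox F p y)
  -- After the subgradient inequality `h1`, the leftover is `p/2` times the squared distance of the
  -- residuals `x - J_p x` and `y - J_p y`.
  nlinarith [mul_nonneg hp' (sq_nonneg ‖(x - prox F p x) - (y - prox F p y)‖)]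

/-- The proximal point of `x` is a competitor in the infimum at `y`. With the tangent bound from
below, this gives differentiability. -/
theorem moreauYosida_le_add_inner (hF : IsProperConvexLSC F) (hp : 1 ≤ p) (x y : E q) :
    (moreauYosida F p y).toReal ≤ (moreauYosida F p x).toReal +
      inner ℝ (yosida F p x) (y - x) + (p : ℝ) / 2 * ‖y - x‖ ^ 2 := by
  have h1 : moreauYosida F p y ≤ _ := iInf_le _ (prox F p x)
  rw [← hF.coe_toReal_prox hp x, ← hF.coe_toReal_moreauYosida hp, ← EReal.coe_add,
    EReal.coe_le_coe_iff] at h1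
  rw [hF.toReal_moreauYosida hp x]
  have h2 : y - prox F p x = (x - prox F p x) + (y - x) := by abel
  rw [h2, norm_add_sq_real] at h1
  simp only [yosida, inner_smul_left, RCLike.conj_to_real]
  linarith

theorem moreauYosida_one_le (hF : IsProperConvexLSC F) (hp : 1 ≤ p) (x : E q) :
    (moreauYosida F 1 x).toReal ≤ (moreauYosida F p x).toReal := by
  have h1 : moreauYosida F 1 x ≤ moreauYosida F p x := by
    unfold moreauYosida
    gcongr with z
  rwa [← hF.coe_toReal_moreauYosida hp, ← hF.coe_toReal_moreauYosida le_rfl,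
    EReal.coe_le_coe_iff] at h1

theorem hasGradientAt_moreauYosida (hF : IsProperConvexLSC F) (hp : 1 ≤ p) (x : E q) :
    HasGradientAt (fun y => (moreauYosida F p y).toReal) (yosida F p x) x :=
  hasGradientAt_of_add_inner_le (hF.moreauYosida_add_inner_le hp x)
    (hF.moreauYosida_le_add_inner hp x)

theorem gradMoreauYosida_eq (hF : IsProperConvexLSC F) (hp : 1 ≤ p) (x : E q) :
    gradMoreauYosida F p x = yosida F p x :=
  (hF.hasGradientAt_moreauYosida hp x).gradient

/-- Regularizations with uniformly bounded gradients are bounded at every point. -/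
theorem exists_moreauYosida_le (hF : IsProperConvexLSC F) (hgrad : UniformGradientBound F)
    (x : E q) : ∃ C : ℝ, ∀ p : ℕ, 1 ≤ p → (moreauYosida F p x).toReal ≤ C := by
  obtain ⟨C, hC⟩ := hgrad
  obtain ⟨y, hy⟩ := hF.dom_nonempty
  obtain ⟨α, hα⟩ := hF.exists_eq_coe hy
  refine ⟨α + C * ‖y - x‖, fun p hp => ?_⟩
  have h1 := hF.moreauYosida_add_inner_le hp x y
  have h2 : (moreauYosida F p y).toReal ≤ α := by
    have : moreauYosida F p y ≤ F y + (((p : ℝ) / 2 * ‖y - y‖ ^ 2 : ℝ) : EReal) := iInf_le _ y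
    rw [← hF.coe_toReal_moreauYosida hp, hα, ← EReal.coe_add, EReal.coe_le_coe_iff] at this
    simpa using this
  have h3 := hC p hp x
  rw [hF.gradMoreauYosida_eq hp] at h3
  have h4 := abs_le.1 (abs_real_inner_le_norm (yosida F p x) (y - x))
  have h5 : ‖yosida F p x‖ * ‖y - x‖ ≤ C * ‖y - x‖ := by gcongr
  linarith [h4.1]

theorem exists_moreauYosida_le_of_iSup_lt_top (hF : IsProperConvexLSC F) {x : E q}
    (hx : (⨆ (p : ℕ) (_ : 1 ≤ p), moreauYosida F p x) < ⊤) :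
    ∃ C : ℝ, ∀ p : ℕ, 1 ≤ p → (moreauYosida F p x).toReal ≤ C := by
  refine ⟨(⨆ (p : ℕ) (_ : 1 ≤ p), moreauYosida F p x).toReal, fun p hp => ?_⟩
  have h : moreauYosida F p x ≤ ⨆ (p : ℕ) (_ : 1 ≤ p), moreauYosida F p x :=
    le_iSup₂ (f := fun (p : ℕ) (_ : 1 ≤ p) => moreauYosida F p x) p hp
  refine EReal.toReal_le_toReal h ?_ hx.ne
  rw [hF.moreauYosida_eq hp]
  exact EReal.coe_ne_bot _

end IsProperConvexLSC

/-! ### Differential inequalities on a compact interval. -/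

theorem antitoneOn_Icc_of_hasDerivWithinAt_nonpos {a b : ℝ} {g g' : ℝ → ℝ}
    (hg : ∀ t ∈ Icc a b, HasDerivWithinAt g (g' t) (Icc a b) t) (hg' : ∀ t ∈ Icc a b, g' t ≤ 0) :
    AntitoneOn g (Icc a b) :=
  antitoneOn_of_hasDerivWithinAt_nonpos (convex_Icc a b)
    (fun t ht => (hg t ht).continuousWithinAt)
    (fun t ht => (hg t (interior_subset ht)).mono interior_subset)
    (fun t ht => hg' t (interior_subset ht))

theorem monotoneOn_Icc_of_hasDerivWithinAt_nonneg {a b : ℝ} {g g' : ℝ → ℝ}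
    (hg : ∀ t ∈ Icc a b, HasDerivWithinAt g (g' t) (Icc a b) t) (hg' : ∀ t ∈ Icc a b, 0 ≤ g' t) :
    MonotoneOn g (Icc a b) :=
  monotoneOn_of_hasDerivWithinAt_nonneg (convex_Icc a b)
    (fun t ht => (hg t ht).continuousWithinAt)
    (fun t ht => (hg t (interior_subset ht)).mono interior_subset)
    (fun t ht => hg' t (interior_subset ht))

/-- Grönwall's inequality for `D' ≤ c D + w'` with `w' ≥ 0`. -/
theorem le_exp_mul_of_hasDerivWithinAt_le {a b c : ℝ} (hc : 0 ≤ c) {D D' w w' : ℝ → ℝ}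
    (hD : ∀ t ∈ Icc a b, HasDerivWithinAt D (D' t) (Icc a b) t)
    (hw : ∀ t ∈ Icc a b, HasDerivWithinAt w (w' t) (Icc a b) t)
    (hw' : ∀ t ∈ Icc a b, 0 ≤ w' t) (hle : ∀ t ∈ Icc a b, D' t ≤ c * D t + w' t)
    {t : ℝ} (ht : t ∈ Icc a b) :
    D t ≤ Real.exp (c * (t - a)) * (D a + (w t - w a)) := by
  -- The exponential weight is at most 1 and `w' ≥ 0`, so `w` can be subtracted unweighted and the
  -- difference still decreases.
  have hS : ∀ s ∈ Icc a b, HasDerivWithinAt (fun s => Real.exp (-(c * (s - a))) * D s - w s)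
      (Real.exp (-(c * (s - a))) * (-c) * D s + Real.exp (-(c * (s - a))) * D' s - w' s)
      (Icc a b) s := by
    intro s hs
    have h1 : HasDerivAt (fun s => -(c * (s - a))) (-c) s := by
      simpa using! (((hasDerivAt_id s).sub_const a).const_mul c).neg
    exact (h1.exp.hasDerivWithinAt.mul (hD s hs)).sub (hw s hs)
  have hanti := antitoneOn_Icc_of_hasDerivWithinAt_nonpos hS fun s hs => by
    have h1 : Real.exp (-(c * (s - a))) ≤ 1 :=
      Real.exp_le_one_iff.2 (neg_nonpos.2 (mul_nonneg hc (sub_nonneg.2 hs.1)))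
    have h2 := mul_le_mul_of_nonneg_left (hle s hs) (Real.exp_pos (-(c * (s - a)))).le
    nlinarith [hw' s hs]
  have h := hanti (left_mem_Icc.2 (ht.1.trans ht.2)) ht ht.1
  simp only [sub_self, mul_zero, neg_zero, Real.exp_zero, one_mul, Real.exp_neg] at h
  have hpos := Real.exp_pos (c * (t - a))
  have h' : (Real.exp (c * (t - a)))⁻¹ * D t ≤ D a + (w t - w a) := by linarith
  calc D t = Real.exp (c * (t - a)) * ((Real.exp (c * (t - a)))⁻¹ * D t) := by
        field_simp
    _ ≤ _ := by gcongr

/-! ### Global solvability of Lipschitz differential equations. -/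

section Ode

variable {H : Type*} [NormedAddCommGroup H] [InnerProductSpace ℝ H]

/-- The radial retraction onto the closed ball of radius `r` about `c`. -/
noncomputable def radialRetraction (c : H) (r : ℝ) (x : H) : H :=
  c + (r / max r ‖x - c‖) • (x - c)

theorem radialRetraction_of_norm_le {c : H} {r : ℝ} (hr : 0 < r) {x : H} (hx : ‖x - c‖ ≤ r) :
    radialRetraction c r x = x := by
  rw [radialRetraction, max_eq_left hx, div_self hr.ne', one_smul, add_sub_cancel]

theorem norm_radialRetraction_sub_le {c : H} {r : ℝ} (hr : 0 < r) (x : H) :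
    ‖radialRetraction c r x - c‖ ≤ min r ‖x - c‖ := by
  have hm : 0 < max r ‖x - c‖ := lt_max_of_lt_left hr
  rw [radialRetraction, add_sub_cancel_left, norm_smul, Real.norm_of_nonneg (by positivity)]
  refine le_min ?_ ?_
  · rw [div_mul_eq_mul_div, div_le_iff₀ hm]
    gcongr
    exact le_max_right _ _
  · exact mul_le_of_le_one_left (norm_nonneg _) ((div_le_one hm).2 (le_max_left _ _))

/-- The constant 2 is not sharp, but it enters only the Lipschitz constant in Picard-Lindelöf, not
the a priori bound. -/
theorem lipschitzWith_radialRetraction {r : ℝ} (hr : 0 < r) (c : H) :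
    LipschitzWith 2 (radialRetraction c r) := by
  refine LipschitzWith.of_dist_le_mul fun x y => ?_
  rw [dist_eq_norm, dist_eq_norm]
  set a := max r ‖x - c‖
  set b := max r ‖y - c‖
  have ha : 0 < a := lt_max_of_lt_left hr
  have hb : 0 < b := lt_max_of_lt_left hr
  have hra : r ≤ a := le_max_left _ _
  have hyb : ‖y - c‖ ≤ b := le_max_right _ _
  have h1 : radialRetraction c r x - radialRetraction c r y =
      (r / a) • (x - y) + (r / a * ((b - a) / b)) • (y - c) := by
    have : r / a * ((b - a) / b) = r / a - r / b := by field_simp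
    rw [this, radialRetraction, radialRetraction]
    module
  have h2 : |b - a| ≤ ‖x - y‖ := by
    have h3 : |b - a| ≤ |‖y - c‖ - ‖x - c‖| := by
      simpa using abs_max_sub_max_le_max r ‖y - c‖ r ‖x - c‖
    have h4 := abs_norm_sub_norm_le (y - c) (x - c)
    rw [sub_sub_sub_cancel_right, norm_sub_rev y x] at h4
    exact h3.trans h4
  have h5 : r / a ≤ 1 := (div_le_one ha).2 hra
  have h6 : 0 ≤ r / a := by positivity
  calc ‖radialRetraction c r x - radialRetraction c r y‖
      ≤ ‖(r / a) • (x - y)‖ + ‖(r / a * ((b - a) / b)) • (y - c)‖ := h1 ▸ norm_add_le _ _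
    _ = r / a * ‖x - y‖ + r / a * (|b - a| * (‖y - c‖ / b)) := by
        rw [norm_smul, norm_smul, norm_mul, norm_div (b - a), Real.norm_of_nonneg h6,
          Real.norm_of_nonneg hb.le, Real.norm_eq_abs]
        ring
    _ ≤ 1 * ‖x - y‖ + 1 * (‖x - y‖ * 1) := by
        gcongr
        exact (div_le_one hb).2 hyb
    _ = _ := by push_cast; ring

theorem two_mul_inner_le_of_norm_le {x v : H} {K M : ℝ} (hv : ‖v‖ ≤ K * ‖x‖ + M) :
    2 * inner ℝ x v ≤ (2 * K + 1) * ‖x‖ ^ 2 + M ^ 2 := by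
  have h1 := real_inner_le_norm x v
  have h2 : ‖x‖ * ‖v‖ ≤ ‖x‖ * (K * ‖x‖ + M) := by gcongr
  nlinarith [sq_nonneg (‖x‖ - M)]

/-- A differential equation with a globally Lipschitz vector field has a solution on every compact
interval. -/
theorem exists_hasDerivWithinAt_of_lipschitzWith [CompleteSpace H] {T : ℝ} (hT : 0 ≤ T)
    {v : ℝ → H → H} {K : NNReal} (hv : ∀ t ∈ Icc 0 T, LipschitzWith K (v t))
    (hvc : ∀ x, ContinuousOn (fun t => v t x) (Icc 0 T)) (u₀ : H) :
    ∃ u : ℝ → H, u 0 = u₀ ∧ ∀ t ∈ Icc 0 T, HasDerivWithinAt u (v t (u t)) (Icc 0 T) t := by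
  obtain ⟨M, hM⟩ := isCompact_Icc.exists_bound_of_continuousOn (hvc u₀)
  have hM0 : 0 ≤ M := (norm_nonneg _).trans (hM 0 (left_mem_Icc.2 hT))
  -- The Grönwall bound for `‖u - u₀‖²`, plus 1. As `r ≥ 1`, `‖u - u₀‖² ≤ r` forces `‖u - u₀‖ ≤ r`,
  -- so the truncation is never active on the solution.
  set r : ℝ := Real.exp ((2 * K + 1) * T) * (M ^ 2 * T) + 1 with hr
  have hr1 : 1 ≤ r := by 
    have : 0 ≤ Real.exp ((2 * K + 1) * T) * (M ^ 2 * T) := by positivity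
    linarith
  have hr0 : 0 < r := by linarith
  -- Both halves of the minimum are used: `r` bounds the truncated field, so Picard-Lindelöf reaches
  -- time `T`; `‖x - u₀‖` gives a Grönwall bound independent of `r`, so the choice of `r` is not
  -- circular.
  have hgrowth : ∀ t ∈ Icc 0 T, ∀ x,
      ‖v t (radialRetraction u₀ r x)‖ ≤ K * min r ‖x - u₀‖ + M := by
    intro t ht x
    have h1 := (hv t ht).norm_sub_le (radialRetraction u₀ r x) u₀
    have h2 := norm_le_norm_sub_add (v t (radialRetraction u₀ r x)) (v t u₀)
    have h3 : K * ‖radialRetraction u₀ r x - u₀‖ ≤ K * min r ‖x - u₀‖ := by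
      gcongr
      exact norm_radialRetraction_sub_le hr0 x
    linarith [hM t ht]
  have hPL : IsPicardLindelof (fun t x => v t (radialRetraction u₀ r x))
      (⟨0, left_mem_Icc.2 hT⟩ : Icc 0 T) u₀ (Real.toNNReal ((K * r + M) * T)) 0
      (Real.toNNReal (K * r + M)) (K * 2) := by
    have h0 : 0 ≤ K * r + M := by positivity
    refine ⟨fun t ht => ?_, fun x _ => hvc _, fun t ht x _ => ?_, ?_⟩
    · exact ((hv t ht).comp (lipschitzWith_radialRetraction hr0 u₀)).lipschitzOnWith
    · rw [Real.coe_toNNReal _ h0]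
      refine (hgrowth t ht x).trans ?_
      gcongr
      exact min_le_left _ _
    · rw [Real.coe_toNNReal _ h0, Real.coe_toNNReal _ (mul_nonneg h0 hT)]
      simp [hT]
  obtain ⟨u, hu0, hu⟩ := hPL.exists_eq_forall_mem_Icc_hasDerivWithinAt₀
  refine ⟨u, hu0, fun t ht => ?_⟩
  have hbound : ‖u t - u₀‖ ^ 2 ≤ r := by
    have h1 := le_exp_mul_of_hasDerivWithinAt_le (a := 0) (b := T) (c := 2 * K + 1)
      (by positivity) (D := fun t => ‖u t - u₀‖ ^ 2) (w := fun t => M ^ 2 * t)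
      (w' := fun _ => M ^ 2)
      (fun s hs => ((hu s hs).sub_const u₀).norm_sq)
      (fun s _ => by simpa using ((hasDerivAt_id s).const_mul (M ^ 2)).hasDerivWithinAt)
      (fun s _ => sq_nonneg M)
      (fun s hs => two_mul_inner_le_of_norm_le ((hgrowth s hs (u s)).trans (by
        gcongr
        exact min_le_right _ _))) ht
    have h0 : u 0 - u₀ = 0 := sub_eq_zero.2 hu0
    simp only [h0, norm_zero, sub_zero, mul_zero] at h1
    refine h1.trans ?_
    have h2 : Real.exp ((2 * K + 1) * t) * (0 ^ 2 + M ^ 2 * t) ≤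
        Real.exp ((2 * K + 1) * T) * (M ^ 2 * T) := by
      have ht0 : 0 ≤ t := ht.1
      have htT : t ≤ T := ht.2
      rw [zero_pow two_ne_zero, zero_add]
      gcongr
    linarith
  have h := hu t ht
  rwa [radialRetraction_of_norm_le hr0 (by nlinarith [norm_nonneg (u t - u₀)])] at h

end Ode

/-! ### Absolute continuity: stability under limits and an almost everywhere Grönwall inequality. -/

section AbsolutelyContinuous

open AbsolutelyContinuousOnInterval

theorem absolutelyContinuousOnInterval_of_dist_le_add {X Y Z : Type*} [PseudoMetricSpace X]
    [PseudoMetricSpace Y] [PseudoMetricSpace Z] {g : ℝ → Z} {g₁ : ℝ → X} {g₂ : ℝ → Y} {a b : ℝ}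
    (h₁ : AbsolutelyContinuousOnInterval g₁ a b) (h₂ : AbsolutelyContinuousOnInterval g₂ a b)
    (h : ∀ s t, dist (g s) (g t) ≤ dist (g₁ s) (g₁ t) + dist (g₂ s) (g₂ t)) :
    AbsolutelyContinuousOnInterval g a b := by
  refine squeeze_zero (fun _ => Finset.sum_nonneg fun _ _ => dist_nonneg) (fun I => ?_)
    (by simpa using Tendsto.add h₁ h₂)
  rw [← Finset.sum_add_distrib]
  exact Finset.sum_le_sum fun i _ => h _ _

theorem absolutelyContinuousOnInterval_of_dist_le {X Z : Type*} [PseudoMetricSpace X]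
    [PseudoMetricSpace Z] {g : ℝ → Z} {g₁ : ℝ → X} {a b : ℝ}
    (h₁ : AbsolutelyContinuousOnInterval g₁ a b)
    (h : ∀ s t, dist (g s) (g t) ≤ dist (g₁ s) (g₁ t)) :
    AbsolutelyContinuousOnInterval g a b :=
  squeeze_zero (fun _ => Finset.sum_nonneg fun _ _ => dist_nonneg)
    (fun _ => Finset.sum_le_sum fun _ _ => h _ _) h₁

/-- The increments of a continuous monotone function over disjoint subintervals sum up to at most
its total increment. -/
theorem sum_dist_le_of_mem_disjWithin {V : ℝ → ℝ} {a b : ℝ} (hab : a ≤ b)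
    (hV : MonotoneOn V (Icc a b)) (hVc : ContinuousOn V (Icc a b))
    {I : ℕ × (ℕ → ℝ × ℝ)} (hI : I ∈ disjWithin a b) :
    ∑ i ∈ Finset.range I.1, dist (V (I.2 i).1) (V (I.2 i).2) ≤ V b - V a := by
  -- Extended by constants, `V` defines a Stieltjes measure; increments become measures of disjoint
  -- intervals, and additivity does the summation.
  let S : StieltjesFunction ℝ :=
    { toFun := fun t => V (projIcc a b hab t)
      mono' := fun s t hst => hV (projIcc a b hab s).2 (projIcc a b hab t).2
        (monotone_projIcc hab hst)
      right_continuous' := fun t => Continuous.continuousWithinAt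
        ((continuousOn_iff_continuous_domRestrict.1 hVc).comp continuous_projIcc) }
  have hS : ∀ t ∈ Icc a b, S t = V t := fun t ht => by
    change V (projIcc a b hab t) = V t
    rw [projIcc_of_mem hab ht]
  have hmem : ∀ i ∈ Finset.range I.1, (I.2 i).1 ∈ Icc a b ∧ (I.2 i).2 ∈ Icc a b := by
    simpa only [uIcc_of_le hab] using hI.1
  have hdist : ∀ i ∈ Finset.range I.1, ENNReal.ofReal (dist (V (I.2 i).1) (V (I.2 i).2)) =
      S.measure (uIoc (I.2 i).1 (I.2 i).2) := by
    intro i hi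
    obtain ⟨h1, h2⟩ := hmem i hi
    rcases le_total (I.2 i).1 (I.2 i).2 with h | h
    · rw [uIoc_of_le h, S.measure_Ioc, hS _ h1, hS _ h2, Real.dist_eq, abs_sub_comm,
        abs_of_nonneg (sub_nonneg.2 (hV h1 h2 h))]
    · rw [uIoc_of_ge h, S.measure_Ioc, hS _ h1, hS _ h2, Real.dist_eq,
        abs_of_nonneg (sub_nonneg.2 (hV h2 h1 h))]
  have hle : V a ≤ V b := hV (left_mem_Icc.2 hab) (right_mem_Icc.2 hab) hab
  rw [← ENNReal.ofReal_le_ofReal_iff (sub_nonneg.2 hle),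
    ENNReal.ofReal_sum_of_nonneg fun _ _ => dist_nonneg, Finset.sum_congr rfl hdist,
    ← measure_biUnion_finset hI.2 fun _ _ => measurableSet_uIoc]
  calc _ ≤ S.measure (uIoc a b) := measure_mono (biUnion_uIoc_subset_of_mem_disjWithin hI)
    _ = _ := by rw [uIoc_of_le hab, S.measure_Ioc, hS _ (left_mem_Icc.2 hab),
        hS _ (right_mem_Icc.2 hab)]

/-- A pointwise limit of curves of uniformly bounded energy is absolutely continuous. -/
theorem absolutelyContinuousOnInterval_of_tendsto {X : Type*} [PseudoMetricSpace X] {a b M : ℝ}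
    (hab : a ≤ b) {u : ℝ → X} {up : ℕ → ℝ → X} {V : ℕ → ℝ → ℝ}
    (hup : ∀ t ∈ Icc a b, Tendsto (fun p => up p t) atTop (𝓝 (u t)))
    (hV : ∀ᶠ p in atTop, MonotoneOn (V p) (Icc a b) ∧ ContinuousOn (V p) (Icc a b) ∧
      V p b - V p a ≤ M ∧ ∀ s ∈ Icc a b, ∀ t ∈ Icc a b,
        dist (up p s) (up p t) ^ 2 ≤ dist s t * dist (V p s) (V p t)) :
    AbsolutelyContinuousOnInterval u a b := by
  rw [absolutelyContinuousOnInterval_iff]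
  intro ε hε
  have hM : 0 ≤ M := by
    obtain ⟨p, hp, -, hM, -⟩ := hV.exists
    linarith [hp (left_mem_Icc.2 hab) (right_mem_Icc.2 hab) hab]
  -- By Cauchy-Schwarz the sum of increments is at most `√(ℓ M)` for each large `p`, hence in the
  -- limit; the `+ 1` covers `M = 0`.
  refine ⟨ε ^ 2 / (M + 1), by positivity, fun I hI hlen => ?_⟩
  have hmem : ∀ i ∈ Finset.range I.1, (I.2 i).1 ∈ Icc a b ∧ (I.2 i).2 ∈ Icc a b := by
    simpa only [uIcc_of_le hab] using hI.1
  set ℓ := ∑ i ∈ Finset.range I.1, dist (I.2 i).1 (I.2 i).2 with hℓ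
  have hℓ0 : 0 ≤ ℓ := Finset.sum_nonneg fun _ _ => dist_nonneg
  have key : ∀ᶠ p in atTop,
      ∑ i ∈ Finset.range I.1, dist (up p (I.2 i).1) (up p (I.2 i).2) ≤ Real.sqrt (ℓ * M) := by
    filter_upwards [hV] with p ⟨hmono, hcont, hMp, hd⟩
    refine Real.le_sqrt_of_sq_le ?_
    calc (∑ i ∈ Finset.range I.1, dist (up p (I.2 i).1) (up p (I.2 i).2)) ^ 2
        ≤ (∑ i ∈ Finset.range I.1, dist (I.2 i).1 (I.2 i).2) *
          ∑ i ∈ Finset.range I.1, dist (V p (I.2 i).1) (V p (I.2 i).2) :=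
          Finset.sum_sq_le_sum_mul_sum_of_sq_le_mul _ (fun _ _ => dist_nonneg)
            (fun _ _ => dist_nonneg) fun i hi => hd _ (hmem i hi).1 _ (hmem i hi).2
      _ ≤ ℓ * M := by
          gcongr
          exact (sum_dist_le_of_mem_disjWithin hab hmono hcont hI).trans hMp
  have hlim : Tendsto (fun p => ∑ i ∈ Finset.range I.1, dist (up p (I.2 i).1) (up p (I.2 i).2))
      atTop (𝓝 (∑ i ∈ Finset.range I.1, dist (u (I.2 i).1) (u (I.2 i).2))) :=
    tendsto_finsetSum _ fun i hi => (hup _ (hmem i hi).1).dist (hup _ (hmem i hi).2)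
  refine (le_of_tendsto hlim key).trans_lt ((Real.sqrt_lt' hε).2 ?_)
  have h1 : ℓ * M ≤ ℓ * (M + 1) := by nlinarith
  have h2 : ℓ * (M + 1) < ε ^ 2 := (lt_div_iff₀ (by positivity)).1 hlen
  linarith

/-- An absolutely continuous function with almost everywhere `D' ≤ c D` that vanishes initially is
nonpositive. -/
theorem nonpos_of_absolutelyContinuousOnInterval {T c : ℝ} {D : ℝ → ℝ}
    (hD : AbsolutelyContinuousOnInterval D 0 T) (h0 : D 0 ≤ 0)
    (hle : ∀ᵐ t, t ∈ Ioo 0 T → DifferentiableAt ℝ D t ∧ deriv D t ≤ c * D t)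
    {t : ℝ} (ht : t ∈ Icc 0 T) : D t ≤ 0 := by
  have hE : ContDiff ℝ 1 fun s : ℝ => Real.exp (-(c * s)) := by fun_prop
  have hac : AbsolutelyContinuousOnInterval (fun s => Real.exp (-(c * s)) * D s) 0 t := by
    refine AbsolutelyContinuousOnInterval.mul (f := fun s => Real.exp (-(c * s))) (g := D)
      hE.contDiffOn.absolutelyContinuousOnInterval (hD.mono ?_)
    rw [uIcc_of_le ht.1, uIcc_of_le (ht.1.trans ht.2)]
    exact Icc_subset_Icc_right ht.2
  have hint := hac.integral_deriv_eq_sub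
  have hnonpos : ∫ s in (0 : ℝ)..t, deriv (fun s => Real.exp (-(c * s)) * D s) s ≤ 0 := by
    rw [intervalIntegral.integral_of_le ht.1, integral_Ioc_eq_integral_Ioo]
    refine integral_nonpos_of_ae ?_
    rw [EventuallyLE, ae_restrict_iff' measurableSet_Ioo]
    filter_upwards [hle] with s hs hst
    obtain ⟨h1, h2⟩ := hs ⟨hst.1, hst.2.trans_le ht.2⟩
    have h3 : HasDerivAt (fun s => -(c * s)) (-c) s := by
      simpa using! ((hasDerivAt_id s).const_mul c).neg
    have h4 : deriv (fun s => Real.exp (-(c * s)) * D s) s =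
        Real.exp (-(c * s)) * (-c) * D s + Real.exp (-(c * s)) * deriv D s :=
      (h3.exp.mul h1.hasDerivAt).deriv
    rw [h4, Pi.zero_apply]
    nlinarith [mul_le_mul_of_nonneg_left h2 (Real.exp_pos (-(c * s))).le]
  rw [hint] at hnonpos
  simp only [mul_zero, neg_zero, Real.exp_zero, one_mul] at hnonpos
  by_contra hpos
  have := mul_pos (Real.exp_pos (-(c * t))) (not_le.1 hpos)
  linarith

end AbsolutelyContinuous

/-! ### Abstract Yosida approximations: uniqueness and estimates uniform in `p`. -/

/-- `a p` are the Yosida approximations of the monotone operator `A` (whose resolvents are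
`x ↦ x - p⁻¹ • a p x`), and they are the gradients of the convex functions `Φ p`, which decrease
to `Φ 1` as `p` decreases. -/
structure IsYosidaApproximation {H : Type*} [NormedAddCommGroup H] [InnerProductSpace ℝ H]
    (A : H → Set H) (a : ℕ → H → H) (Φ : ℕ → H → ℝ) : Prop where
  monotone : ∀ {x y ξ η : H}, ξ ∈ A x → η ∈ A y → 0 ≤ inner ℝ (ξ - η) (x - y)
  mem : ∀ {p : ℕ}, 1 ≤ p → ∀ x, a p x ∈ A (x - (p : ℝ)⁻¹ • a p x)
  add_inner_le : ∀ {p : ℕ}, 1 ≤ p → ∀ x y, Φ p x + inner ℝ (a p x) (y - x) ≤ Φ p y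
  le_add_inner : ∀ {p : ℕ}, 1 ≤ p → ∀ x y,
    Φ p y ≤ Φ p x + inner ℝ (a p x) (y - x) + (p : ℝ) / 2 * ‖y - x‖ ^ 2
  one_le : ∀ {p : ℕ}, 1 ≤ p → ∀ x, Φ 1 x ≤ Φ p x

/-- `u` solves `u' + a(u) = b(t, u)` on `[0, T]` with `u(0) = u₀`. -/
structure IsClassicalSolution {H : Type*} [NormedAddCommGroup H] [InnerProductSpace ℝ H]
    (a : H → H) (b : ℝ → H → H) (u₀ : H) (T : ℝ) (u : ℝ → H) : Prop where
  init : u 0 = u₀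
  hasDerivWithinAt : ∀ t ∈ Icc 0 T, HasDerivWithinAt u (b t (u t) - a (u t)) (Icc 0 T) t

/-- `u` is absolutely continuous on `[0, T]` with `u(0) = u₀` and `u' + A(u) ∋ b(t, u)` almost
everywhere. -/
structure IsStrongSolution {H : Type*} [NormedAddCommGroup H] [InnerProductSpace ℝ H]
    (A : H → Set H) (b : ℝ → H → H) (u₀ : H) (T : ℝ) (u : ℝ → H) : Prop where
  absCont : AbsolutelyContinuousOnInterval u 0 T
  init : u 0 = u₀
  incl : ∀ᵐ t : ℝ, t ∈ Ioo 0 T → DifferentiableAt ℝ u t ∧ b t (u t) - deriv u t ∈ A (u t)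

variable {H : Type*} [NormedAddCommGroup H] [InnerProductSpace ℝ H]
  {A : H → Set H} {a : ℕ → H → H} {Φ : ℕ → H → ℝ} {b : ℝ → H → H} {K : NNReal} {u₀ : H} {T : ℝ}

namespace IsYosidaApproximation

/-- Cocoercivity, from monotonicity of `A` at the two resolvent points. It yields both monotonicity
and the Lipschitz constant `p` of `a p`. -/
theorem inv_mul_norm_sq_le (hA : IsYosidaApproximation A a Φ) {p : ℕ} (hp : 1 ≤ p) (x y : H) :
    (p : ℝ)⁻¹ * ‖a p x - a p y‖ ^ 2 ≤ inner ℝ (a p x - a p y) (x - y) := by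
  have h := hA.monotone (hA.mem hp x) (hA.mem hp y)
  have h2 : x - (p : ℝ)⁻¹ • a p x - (y - (p : ℝ)⁻¹ • a p y) =
      (x - y) - (p : ℝ)⁻¹ • (a p x - a p y) := by module
  rw [h2, inner_sub_right, inner_smul_right, real_inner_self_eq_norm_sq] at h
  linarith

theorem inner_nonneg (hA : IsYosidaApproximation A a Φ) {p : ℕ} (hp : 1 ≤ p) (x y : H) :
    0 ≤ inner ℝ (a p x - a p y) (x - y) :=
  le_trans (by positivity) (hA.inv_mul_norm_sq_le hp x y)

theorem lipschitzWith (hA : IsYosidaApproximation A a Φ) {p : ℕ} (hp : 1 ≤ p) :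
    LipschitzWith p (a p) := by
  refine LipschitzWith.of_dist_le_mul fun x y => ?_
  rw [dist_eq_norm, dist_eq_norm, NNReal.coe_natCast]
  have hp' : (0 : ℝ) < p := by positivity
  have h := (hA.inv_mul_norm_sq_le hp x y).trans (real_inner_le_norm _ _)
  rw [inv_mul_le_iff₀ hp', pow_two] at h
  rcases (norm_nonneg (a p x - a p y)).eq_or_lt with h0 | h0
  · rw [← h0]; positivity
  · exact le_of_mul_le_mul_left (by linarith) h0

/-- Maximality of the operator. -/
theorem mem_of_forall (hA : IsYosidaApproximation A a Φ) {x ξ : H}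
    (h : ∀ y, ∀ η ∈ A y, 0 ≤ inner ℝ (ξ - η) (x - y)) : ξ ∈ A x := by
  -- Minty's argument: tested against the resolvent of `x + ξ`, the hypothesis reads `-‖ξ - a 1 (x +
  -- ξ)‖² ≥ 0`, so that resolvent is `x` itself.
  have hmem := hA.mem le_rfl (x + ξ)
  rw [Nat.cast_one, inv_one, one_smul] at hmem
  have h1 := h _ _ hmem
  have h2 : x - (x + ξ - a 1 (x + ξ)) = -(ξ - a 1 (x + ξ)) := by abel
  rw [h2, inner_neg_right, real_inner_self_eq_norm_sq] at h1
  have h3 : ξ - a 1 (x + ξ) = 0 := by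
    rw [← norm_eq_zero, ← sq_eq_zero_iff]
    linarith [sq_nonneg ‖ξ - a 1 (x + ξ)‖]
  rw [sub_eq_zero] at h3
  rwa [← h3, add_sub_cancel_right] at hmem

/-- Monotonicity between `y` and its resolvent point gives `‖a p y‖² ≤ ⟨η, a p y⟩`. The resulting
bound at a fixed point is uniform in `p`. -/
theorem norm_le_of_mem (hA : IsYosidaApproximation A a Φ) {p : ℕ} (hp : 1 ≤ p) {y η : H}
    (hη : η ∈ A y) : ‖a p y‖ ≤ ‖η‖ := by
  have hp' : (0 : ℝ) < (p : ℝ)⁻¹ := by positivity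
  have h := hA.monotone (hA.mem hp y) hη
  have h2 : y - (p : ℝ)⁻¹ • a p y - y = -((p : ℝ)⁻¹ • a p y) := by abel
  rw [h2, inner_neg_right, inner_smul_right, inner_sub_left, real_inner_self_eq_norm_sq] at h
  have h3 : ‖a p y‖ ^ 2 ≤ inner ℝ η (a p y) := by
    by_contra hlt
    nlinarith [mul_pos hp' (sub_pos.2 (not_le.1 hlt))]
  have h4 := h3.trans (real_inner_le_norm _ _)
  rcases (norm_nonneg (a p y)).eq_or_lt with h0 | h0
  · rw [← h0]; positivity
  · nlinarith

theorem hasGradientAt [CompleteSpace H] (hA : IsYosidaApproximation A a Φ) {p : ℕ} (hp : 1 ≤ p)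
    (x : H) : HasGradientAt (Φ p) (a p x) x :=
  hasGradientAt_of_add_inner_le (hA.add_inner_le hp x) (hA.le_add_inner hp x)

theorem exists_isClassicalSolution [CompleteSpace H] (hA : IsYosidaApproximation A a Φ)
    (hT : 0 ≤ T) (hbK : ∀ t ∈ Icc 0 T, LipschitzWith K (b t))
    (hb : ContinuousOn (Function.uncurry b) (Icc 0 T ×ˢ univ)) (u₀ : H) {p : ℕ} (hp : 1 ≤ p) :
    ∃ u, IsClassicalSolution (a p) b u₀ T u := by
  obtain ⟨u, hu0, hu⟩ := exists_hasDerivWithinAt_of_lipschitzWith hT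
    (v := fun t x => b t x - a p x) (fun t ht => (hbK t ht).sub (hA.lipschitzWith hp))
    (fun x => (hb.comp (f := fun t => (t, x)) (by fun_prop)
      fun t ht => ⟨ht, mem_univ _⟩).sub continuousOn_const) u₀
  exact ⟨u, hu0, hu⟩

theorem inner_sub_le (hbK : ∀ t ∈ Icc 0 T, LipschitzWith K (b t)) {t : ℝ} (ht : t ∈ Icc 0 T)
    (x y : H) : inner ℝ (x - y) (b t x - b t y) ≤ K * ‖x - y‖ ^ 2 := by
  have h1 := real_inner_le_norm (x - y) (b t x - b t y)
  have h2 := mul_le_mul_of_nonneg_left ((hbK t ht).norm_sub_le x y) (norm_nonneg (x - y))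
  linarith

theorem eqOn_of_isClassicalSolution (hA : IsYosidaApproximation A a Φ)
    (hbK : ∀ t ∈ Icc 0 T, LipschitzWith K (b t)) {p : ℕ} (hp : 1 ≤ p) {u v : ℝ → H}
    (hu : IsClassicalSolution (a p) b u₀ T u) (hv : IsClassicalSolution (a p) b u₀ T v) :
    EqOn u v (Icc 0 T) := by
  intro t ht
  have h := le_exp_mul_of_hasDerivWithinAt_le (a := 0) (b := T) (c := 2 * K) (by positivity)
    (D := fun t => ‖u t - v t‖ ^ 2) (w := fun _ => 0) (w' := fun _ => 0)
    (fun s hs => ((hu.hasDerivWithinAt s hs).sub (hv.hasDerivWithinAt s hs)).norm_sq)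
    (fun s _ => hasDerivWithinAt_const _ _ _) (fun _ _ => le_rfl)
    (fun s hs => by
      have h1 := inner_sub_le hbK hs (u s) (v s)
      have h2 := hA.inner_nonneg hp (u s) (v s)
      rw [real_inner_comm] at h2
      have h3 : b s (u s) - a p (u s) - (b s (v s) - a p (v s)) =
        (b s (u s) - b s (v s)) - (a p (u s) - a p (v s)) := by abel
      simp only [Pi.sub_apply]
      rw [h3, inner_sub_right]
      linarith) ht
  have h0 : u 0 - v 0 = 0 := by rw [hu.init, hv.init, sub_self]
  simp only [h0, norm_zero, sub_self, add_zero, zero_pow two_ne_zero, mul_zero] at h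
  have h1 : ‖u t - v t‖ = 0 := by
    rw [← sq_eq_zero_iff]; exact le_antisymm h (sq_nonneg _)
  exact sub_eq_zero.1 (norm_eq_zero.1 h1)

/-- Monotonicity of `A` bounds the derivative of `‖u - v‖²` only almost everywhere; absolute
continuity is what allows this bound to be integrated. -/
theorem eqOn_of_isStrongSolution (hA : IsYosidaApproximation A a Φ)
    (hbK : ∀ t ∈ Icc 0 T, LipschitzWith K (b t)) {u v : ℝ → H}
    (hu : IsStrongSolution A b u₀ T u) (hv : IsStrongSolution A b u₀ T v) :
    EqOn u v (Icc 0 T) := by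
  intro t ht
  have hnorm : AbsolutelyContinuousOnInterval (fun t => ‖u t - v t‖) 0 T :=
    absolutelyContinuousOnInterval_of_dist_le_add hu.absCont hv.absCont fun s r => by
      rw [Real.dist_eq]
      refine (abs_norm_sub_norm_le _ _).trans ?_
      rw [dist_eq_norm, dist_eq_norm, sub_sub_sub_comm]
      exact norm_sub_le _ _
  have hD : AbsolutelyContinuousOnInterval (fun t => ‖u t - v t‖ ^ 2) 0 T := by
    have := hnorm.fun_mul hnorm
    simpa only [pow_two] using this
  have h := nonpos_of_absolutelyContinuousOnInterval (c := 2 * K) hD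
    (by simp [hu.init, hv.init]) (by
      filter_upwards [hu.incl, hv.incl] with s hs₁ hs₂ hs
      obtain ⟨hd₁, hi₁⟩ := hs₁ hs
      obtain ⟨hd₂, hi₂⟩ := hs₂ hs
      have hd : HasDerivAt (fun t => ‖u t - v t‖ ^ 2)
          (2 * inner ℝ (u s - v s) (deriv u s - deriv v s)) s :=
        (hd₁.hasDerivAt.sub hd₂.hasDerivAt).norm_sq
      refine ⟨hd.differentiableAt, ?_⟩
      rw [hd.deriv]
      have h1 := inner_sub_le hbK (Ioo_subset_Icc_self hs) (u s) (v s)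
      have h2 := hA.monotone hi₁ hi₂
      rw [real_inner_comm] at h2
      have h3 : b s (u s) - deriv u s - (b s (v s) - deriv v s) =
        (b s (u s) - b s (v s)) - (deriv u s - deriv v s) := by abel
      rw [h3, inner_sub_right] at h2
      linarith) ht
  have h1 : ‖u t - v t‖ = 0 := by
    rw [← sq_eq_zero_iff]; exact le_antisymm h (sq_nonneg _)
  exact sub_eq_zero.1 (norm_eq_zero.1 h1)

/-- The solutions of the penalized equations are bounded uniformly in `p`. -/
theorem exists_norm_sub_le (hA : IsYosidaApproximation A a Φ) (hT : 0 ≤ T)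
    (hbK : ∀ t ∈ Icc 0 T, LipschitzWith K (b t))
    (hb : ContinuousOn (Function.uncurry b) (Icc 0 T ×ˢ univ)) (u₀ : H) :
    ∃ y : H, ∃ R : ℝ, 0 ≤ R ∧ ∀ p : ℕ, 1 ≤ p → ∀ u, IsClassicalSolution (a p) b u₀ T u →
      ∀ t ∈ Icc 0 T, ‖u t - y‖ ≤ R ∧ ‖b t (u t)‖ ≤ R := by
  -- Any point of the graph serves as centre: monotonicity discards `⟨a p u - a p y, u - y⟩`, and
  -- the remaining `a p y` is bounded by `‖η‖` for all `p`.
  obtain ⟨y, η, hη⟩ : ∃ y η, η ∈ A y := ⟨_, _, hA.mem le_rfl 0⟩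
  obtain ⟨M, hM⟩ := isCompact_Icc.exists_bound_of_continuousOn
    (hb.comp (f := fun t => (t, y)) (by fun_prop) fun t ht => ⟨ht, mem_univ _⟩)
  simp only [Function.comp_apply, Function.uncurry] at hM
  have hM0 : 0 ≤ M := (norm_nonneg _).trans (hM 0 (left_mem_Icc.2 hT))
  set B : ℝ := Real.exp ((2 * K + 1) * T) * (‖u₀ - y‖ ^ 2 + (M + ‖η‖) ^ 2 * T) with hB
  have hB0 : 0 ≤ B := by positivity
  refine ⟨y, Real.sqrt B + K * Real.sqrt B + M, by positivity, fun p hp u hu t ht => ?_⟩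
  have hgrowth : ∀ s ∈ Icc 0 T, ∀ x, ‖b s x‖ ≤ K * ‖x - y‖ + M := by
    intro s hs x
    have h1 := (hbK s hs).norm_sub_le x y
    have h2 := norm_le_norm_sub_add (b s x) (b s y)
    linarith [hM s hs]
  have h := le_exp_mul_of_hasDerivWithinAt_le (a := 0) (b := T) (c := 2 * K + 1) (by positivity)
    (D := fun t => ‖u t - y‖ ^ 2) (w := fun t => (M + ‖η‖) ^ 2 * t)
    (w' := fun _ => (M + ‖η‖) ^ 2)
    (fun s hs => ((hu.hasDerivWithinAt s hs).sub_const y).norm_sq)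
    (fun s _ => by
      simpa using ((hasDerivAt_id s).const_mul ((M + ‖η‖) ^ 2)).hasDerivWithinAt)
    (fun s _ => sq_nonneg _)
    (fun s hs => by
      have h1 : 2 * inner ℝ (u s - y) (b s (u s) - a p y) ≤ _ :=
        two_mul_inner_le_of_norm_le (K := K) (M := M + ‖η‖) (by
          have := norm_sub_le (b s (u s)) (a p y)
          linarith [hgrowth s hs (u s), hA.norm_le_of_mem hp hη])
      have h2 := hA.inner_nonneg hp (u s) y
      rw [real_inner_comm, inner_sub_right] at h2
      rw [inner_sub_right] at h1 ⊢
      linarith) ht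
  simp only [hu.init, sub_zero, mul_zero] at h
  have hsq : ‖u t - y‖ ^ 2 ≤ B := by
    refine h.trans ?_
    have ht0 : 0 ≤ t := ht.1
    have htT : t ≤ T := ht.2
    rw [hB]
    gcongr
  have h1 : ‖u t - y‖ ≤ Real.sqrt B := Real.le_sqrt_of_sq_le hsq
  have h2 : K * ‖u t - y‖ ≤ K * Real.sqrt B := by gcongr
  have h3 : 0 ≤ K * Real.sqrt B := by positivity
  exact ⟨by linarith, by linarith [hgrowth t ht (u t), Real.sqrt_nonneg B]⟩

/-- Energy estimate: the derivatives and the penalization terms are square integrable uniformly in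
`p`, expressed through a primitive `V` of a majorant. -/
theorem exists_energy_bound [CompleteSpace H] (hA : IsYosidaApproximation A a Φ) (hT : 0 ≤ T)
    (hbK : ∀ t ∈ Icc 0 T, LipschitzWith K (b t))
    (hb : ContinuousOn (Function.uncurry b) (Icc 0 T ×ˢ univ)) {C₀ : ℝ}
    (hΦ : ∀ p : ℕ, 1 ≤ p → Φ p u₀ ≤ C₀) :
    ∃ M : ℝ, ∀ p : ℕ, 1 ≤ p → ∀ u, IsClassicalSolution (a p) b u₀ T u →
      ∃ V V' : ℝ → ℝ, (∀ t ∈ Icc 0 T, HasDerivWithinAt V (V' t) (Icc 0 T) t) ∧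
        V 0 = 0 ∧ V T ≤ M ∧ ∀ t ∈ Icc 0 T,
          ‖a p (u t)‖ ^ 2 ≤ V' t ∧ ‖b t (u t) - a p (u t)‖ ^ 2 ≤ V' t := by
  obtain ⟨y, R, hR0, hR⟩ := hA.exists_norm_sub_le hT hbK hb u₀
  refine ⟨2 * C₀ - 2 * (Φ 1 y - ‖a 1 y‖ * R) + R ^ 2 * T, fun p hp u hu => ?_⟩
  -- Since `-2⟨a, b - a⟩ = ‖a‖² + ‖b - a‖² - ‖b‖²` and `‖b‖ ≤ R`, adding `R²` makes `V'` dominate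
  -- both squares; the inner product is the derivative of `Φ p` along `u`.
  refine ⟨fun t => 2 * Φ p u₀ - 2 * Φ p (u t) + R ^ 2 * t,
    fun t => -(2 * inner ℝ (a p (u t)) (b t (u t) - a p (u t))) + R ^ 2, fun t ht => ?_, ?_, ?_,
    fun t ht => ?_⟩
  · have h1 := (hA.hasGradientAt hp (u t)).hasFDerivAt.comp_hasDerivWithinAt t
      (hu.hasDerivWithinAt t ht)
    rw [InnerProductSpace.toDual_apply_apply] at h1
    have h2 := ((hasDerivAt_id t).const_mul (R ^ 2)).hasDerivWithinAt (s := Icc 0 T)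
    simpa using! ((h1.const_mul 2).const_sub (2 * Φ p u₀)).add h2
  · simp [hu.init]
  -- `Φ p (u T)` is bounded below independently of `p` by `Φ 1`, which lies above its tangent at
  -- `y`.
  · have h1 := hA.one_le hp (u T)
    have h2 := hA.add_inner_le le_rfl y (u T)
    have h3 := abs_le.1 (abs_real_inner_le_norm (a 1 y) (u T - y))
    have h4 := mul_le_mul_of_nonneg_left (hR p hp u hu T (right_mem_Icc.2 hT)).1
      (norm_nonneg (a 1 y))
    linarith [hΦ p hp, h3.1]
  · have h1 := (hR p hp u hu t ht).2
    have h2 : ‖b t (u t)‖ ^ 2 ≤ R ^ 2 := by gcongr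
    have h3 := norm_sub_sq_real (b t (u t)) (a p (u t))
    have h4 := sq_nonneg ‖b t (u t) - a p (u t)‖
    have h5 := sq_nonneg ‖a p (u t)‖
    simp only [inner_sub_right, real_inner_self_eq_norm_sq]
    rw [real_inner_comm] at h3
    constructor <;> linarith

end IsYosidaApproximation

/-- A curve whose squared speed is at most `V'` is `1/2`-Hölder with respect to `V`. -/
theorem dist_sq_le_mul_dist {u u' : ℝ → H} {V V' : ℝ → ℝ}
    (hu : ∀ t ∈ Icc 0 T, HasDerivWithinAt u (u' t) (Icc 0 T) t)
    (hV : ∀ t ∈ Icc 0 T, HasDerivWithinAt V (V' t) (Icc 0 T) t)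
    (hle : ∀ t ∈ Icc 0 T, ‖u' t‖ ^ 2 ≤ V' t) {s t : ℝ} (hs : s ∈ Icc 0 T) (ht : t ∈ Icc 0 T) :
    dist (u s) (u t) ^ 2 ≤ dist s t * dist (V s) (V t) := by
  wlog hst : s ≤ t generalizing s t
  · rw [dist_comm (u s), dist_comm s, dist_comm (V s)]
    exact this ht hs (le_of_not_ge hst)
  rcases hst.eq_or_lt with rfl | hst
  · simp
  -- Testing with the mean velocity `w` replaces Cauchy-Schwarz for integrals: `2⟨w, u'⟩ - ‖w‖² ≤
  -- ‖u'‖² ≤ V'`, integrated from `s` to `t`.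
  set w := (t - s)⁻¹ • (u t - u s) with hw
  have hpos : 0 < t - s := sub_pos.2 hst
  have hmono := monotoneOn_Icc_of_hasDerivWithinAt_nonneg
    (g := fun r => V r - 2 * inner ℝ w (u r) + ‖w‖ ^ 2 * r)
    (g' := fun r => V' r - 2 * inner ℝ w (u' r) + ‖w‖ ^ 2)
    (fun r hr => by
      have h1 : HasDerivWithinAt (fun r => inner ℝ w (u r)) (inner ℝ w (u' r)) (Icc 0 T) r :=
        (innerSL ℝ w).hasFDerivAt.comp_hasDerivWithinAt r (hu r hr)
      have h2 := ((hasDerivAt_id r).const_mul (‖w‖ ^ 2)).hasDerivWithinAt (s := Icc 0 T)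
      simpa using! ((hV r hr).sub (h1.const_mul 2)).add h2)
    (fun r hr => by
      have h1 := norm_sub_sq_real w (u' r)
      linarith [sq_nonneg ‖w - u' r‖, hle r hr]) hs ht hst.le
  have hV0 := monotoneOn_Icc_of_hasDerivWithinAt_nonneg hV
    (fun r hr => (sq_nonneg _).trans (hle r hr)) hs ht hst.le
  have h1 : inner ℝ w (u t) - inner ℝ w (u s) = (t - s)⁻¹ * ‖u t - u s‖ ^ 2 := by
    rw [← inner_sub_right, hw, inner_smul_left, RCLike.conj_to_real, real_inner_self_eq_norm_sq]
  have h2 : ‖w‖ ^ 2 = (t - s)⁻¹ ^ 2 * ‖u t - u s‖ ^ 2 := by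
    rw [hw, norm_smul, mul_pow, Real.norm_of_nonneg (by positivity)]
  have h3 : (t - s)⁻¹ * ‖u t - u s‖ ^ 2 ≤ V t - V s := by
    have h4 : ‖w‖ ^ 2 * (t - s) = (t - s)⁻¹ * ‖u t - u s‖ ^ 2 := by
      rw [h2]; field_simp
    simp only at hmono
    nlinarith
  rw [dist_comm (u s), dist_eq_norm, dist_comm s, dist_comm (V s), Real.dist_eq, Real.dist_eq,
    abs_of_pos hpos, abs_of_nonneg (sub_nonneg.2 hV0)]
  rwa [inv_mul_le_iff₀ hpos] at h3

namespace IsYosidaApproximation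

/-- Comparison of the solutions for two penalization parameters. -/
theorem norm_sub_sq_le (hA : IsYosidaApproximation A a Φ)
    (hbK : ∀ t ∈ Icc 0 T, LipschitzWith K (b t)) {p q : ℕ} (hp : 1 ≤ p) (hq : 1 ≤ q)
    {u v : ℝ → H} (hu : IsClassicalSolution (a p) b u₀ T u)
    (hv : IsClassicalSolution (a q) b u₀ T v) {V V' W W' : ℝ → ℝ}
    (hV : ∀ t ∈ Icc 0 T, HasDerivWithinAt V (V' t) (Icc 0 T) t)
    (hV' : ∀ t ∈ Icc 0 T, ‖a p (u t)‖ ^ 2 ≤ V' t) (hV0 : V 0 = 0)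
    (hW : ∀ t ∈ Icc 0 T, HasDerivWithinAt W (W' t) (Icc 0 T) t)
    (hW' : ∀ t ∈ Icc 0 T, ‖a q (v t)‖ ^ 2 ≤ W' t) (hW0 : W 0 = 0)
    {t : ℝ} (ht : t ∈ Icc 0 T) :
    ‖u t - v t‖ ^ 2 ≤ Real.exp (2 * K * t) * (((p : ℝ)⁻¹ + (q : ℝ)⁻¹) * (V t + W t)) := by
  have hp' : (0 : ℝ) < (p : ℝ)⁻¹ := by positivity
  have hq' : (0 : ℝ) < (q : ℝ)⁻¹ := by positivity
  have hVnn : ∀ s ∈ Icc 0 T, 0 ≤ V' s := fun s hs => (sq_nonneg _).trans (hV' s hs)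
  have hWnn : ∀ s ∈ Icc 0 T, 0 ≤ W' s := fun s hs => (sq_nonneg _).trans (hW' s hs)
  have h := le_exp_mul_of_hasDerivWithinAt_le (a := 0) (b := T) (c := 2 * K) (by positivity)
    (D := fun t => ‖u t - v t‖ ^ 2) (w := fun t => ((p : ℝ)⁻¹ + (q : ℝ)⁻¹) * (V t + W t))
    (w' := fun t => ((p : ℝ)⁻¹ + (q : ℝ)⁻¹) * (V' t + W' t))
    (fun s hs => ((hu.hasDerivWithinAt s hs).sub (hv.hasDerivWithinAt s hs)).norm_sq)
    (fun s hs => ((hV s hs).add (hW s hs)).const_mul _)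
    (fun s hs => mul_nonneg (by positivity) (add_nonneg (hVnn s hs) (hWnn s hs)))
    (fun s hs => by
      simp only [Pi.sub_apply]
      have h1 := inner_sub_le hbK hs (u s) (v s)
      -- Monotonicity holds at the resolvent points, not at `u` and `v`; the correction costs at
      -- most `(1/p + 1/q)⟨α, β⟩`, which the energies absorb.
      have h2 := hA.monotone (hA.mem hp (u s)) (hA.mem hq (v s))
      set α := a p (u s)
      set β := a q (v s)
      have h3 : b s (u s) - α - (b s (v s) - β) = (b s (u s) - b s (v s)) - (α - β) := by abel
      have h4 : u s - (p : ℝ)⁻¹ • α - (v s - (q : ℝ)⁻¹ • β) =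
        (u s - v s) - ((p : ℝ)⁻¹ • α - (q : ℝ)⁻¹ • β) := by abel
      have h5 : inner ℝ (α - β) ((p : ℝ)⁻¹ • α - (q : ℝ)⁻¹ • β) =
          (p : ℝ)⁻¹ * ‖α‖ ^ 2 + (q : ℝ)⁻¹ * ‖β‖ ^ 2 -
            ((p : ℝ)⁻¹ + (q : ℝ)⁻¹) * inner ℝ α β := by
        simp only [inner_sub_left, inner_sub_right, inner_smul_right, real_inner_self_eq_norm_sq]
        rw [real_inner_comm α β]
        ring
      have h6 : 2 * inner ℝ α β ≤ ‖α‖ ^ 2 + ‖β‖ ^ 2 := by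
        linarith [norm_sub_sq_real α β, sq_nonneg ‖α - β‖]
      have h7 : ‖α‖ ^ 2 + ‖β‖ ^ 2 ≤ V' s + W' s := add_le_add (hV' s hs) (hW' s hs)
      have h8 : ((p : ℝ)⁻¹ + (q : ℝ)⁻¹) * (2 * inner ℝ α β) ≤
          ((p : ℝ)⁻¹ + (q : ℝ)⁻¹) * (V' s + W' s) :=
        mul_le_mul_of_nonneg_left (h6.trans h7) (by positivity)
      rw [h4, inner_sub_right, h5, real_inner_comm] at h2
      rw [h3, inner_sub_right]
      have h9 : 0 ≤ (p : ℝ)⁻¹ * ‖α‖ ^ 2 := by positivity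
      have h10 : 0 ≤ (q : ℝ)⁻¹ * ‖β‖ ^ 2 := by positivity
      linarith) ht
  simpa [hu.init, hv.init, hV0, hW0] using h

end IsYosidaApproximation

/-! ### Passage to the limit in the penalization parameter. -/

theorem le_of_eventually_sub_le {g : ℝ → ℝ} {g' k t₀ : ℝ} (hg : HasDerivAt g g' t₀)
    (h : ∀ᶠ t in 𝓝[>] t₀, g t - g t₀ ≤ k * (t - t₀)) : g' ≤ k := by
  have hs := (hasDerivWithinAt_iff_tendsto_slope' (self_notMem_Ioi (a := t₀))).1
    (hg.hasDerivWithinAt (s := Ioi t₀))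
  refine le_of_tendsto hs ?_
  filter_upwards [h, self_mem_nhdsWithin] with t ht htt
  rw [slope_def_field, div_le_iff₀ (sub_pos.2 htt)]
  exact ht

/-- A monotone function that controls the increments of `u` from above forces `u' ∈ L²`. -/
theorem memLp_deriv_of_dist_sq_le [CompleteSpace H] (hT : 0 ≤ T) {u : ℝ → H} {V : ℝ → ℝ} (hV : MonotoneOn V (Icc 0 T))
    (hu : ∀ᵐ t : ℝ, t ∈ Ioo 0 T → DifferentiableAt ℝ u t)
    (h : ∀ s ∈ Icc 0 T, ∀ t ∈ Icc 0 T, s < t → ‖u t - u s‖ ^ 2 ≤ (t - s) * (V t - V s)) :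
    MemLp (deriv u) 2 (volume.restrict (Ioo 0 T)) := by
  have hmeas : AEStronglyMeasurable (deriv u) (volume.restrict (Ioo 0 T)) :=
    aestronglyMeasurable_deriv u _
  rw [memLp_two_iff_integrable_sq_norm hmeas]
  -- Monotonicity of `V` alone makes `V'` exist almost everywhere and be integrable; difference
  -- quotients then give `‖u'‖² ≤ V'`.
  have hint : IntervalIntegrable (deriv V) volume 0 T :=
    MonotoneOn.intervalIntegrable_deriv (by rwa [uIcc_of_le hT])
  have hint' : IntegrableOn (deriv V) (Ioo 0 T) volume :=
    ((intervalIntegrable_iff_integrableOn_Ioc_of_le hT).1 hint).mono_set Ioo_subset_Ioc_self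
  refine hint'.mono' (hmeas.norm.pow 2) ?_
  rw [ae_restrict_iff' measurableSet_Ioo]
  filter_upwards [hu, hV.ae_differentiableWithinAt_of_mem] with t h1 h2 ht
  have hd1 := (h1 ht).hasDerivAt
  have hd2 := ((h2 (Ioo_subset_Icc_self ht)).differentiableAt (Icc_mem_nhds ht.1 ht.2)).hasDerivAt
  rw [Real.norm_of_nonneg (by positivity)]
  have hs1 := ((hasDerivWithinAt_iff_tendsto_slope' (self_notMem_Ioi (a := t))).1
    (hd1.hasDerivWithinAt (s := Ioi t))).norm.pow 2
  have hs2 := (hasDerivWithinAt_iff_tendsto_slope' (self_notMem_Ioi (a := t))).1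
    (hd2.hasDerivWithinAt (s := Ioi t))
  refine le_of_tendsto_of_tendsto hs1 hs2 ?_
  filter_upwards [Ioo_mem_nhdsGT ht.2] with s hs
  have hpos : 0 < s - t := sub_pos.2 hs.1
  have h3 := h t (Ioo_subset_Icc_self ht) s ⟨(ht.1.trans hs.1).le, hs.2.le⟩ hs.1
  rw [slope_def_field, slope_def_module, norm_smul, mul_pow, norm_inv, Real.norm_of_nonneg hpos.le,
    le_div_iff₀ hpos]
  calc (s - t)⁻¹ ^ 2 * ‖u s - u t‖ ^ 2 * (s - t)
      ≤ (s - t)⁻¹ ^ 2 * ((s - t) * (V s - V t)) * (s - t) := by gcongr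
    _ = V s - V t := by field_simp

namespace IsYosidaApproximation

/-- A uniform limit of solutions of the penalized equations satisfies the inclusion wherever it is
differentiable. -/
theorem sub_deriv_mem_of_tendstoUniformlyOn (hA : IsYosidaApproximation A a Φ)
    (hb : ContinuousOn (Function.uncurry b) (Icc 0 T ×ˢ univ)) {u : ℝ → H} {up : ℕ → ℝ → H}
    (hup : ∀ p : ℕ, 1 ≤ p → IsClassicalSolution (a p) b u₀ T (up p))
    (hlim : TendstoUniformlyOn up u atTop (Icc 0 T)) {t₀ : ℝ} (ht₀ : t₀ ∈ Ioo 0 T)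
    (hd : DifferentiableAt ℝ u t₀) : b t₀ (u t₀) - deriv u t₀ ∈ A (u t₀) := by
  refine hA.mem_of_forall fun y η hη => ?_
  have ht₀' := Ioo_subset_Icc_self ht₀
  set G : ℝ × H → ℝ := fun z => 2 * inner ℝ (z.2 - y) (Function.uncurry b z - η) with hG
  have hGc : ContinuousOn G (Icc 0 T ×ˢ univ) := by
    refine continuousOn_const.mul (ContinuousOn.inner ?_ (hb.sub continuousOn_const))
    fun_prop
  have htend : Tendsto (fun z : ℕ × ℝ => (z.2, up z.1 z.2)) (atTop ×ˢ 𝓝[Icc 0 T] t₀)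
      (𝓝[Icc 0 T ×ˢ univ] (t₀, u t₀)) := by
    refine tendsto_nhdsWithin_iff.2 ⟨?_, ?_⟩
    · refine (tendsto_snd.mono_right nhdsWithin_le_nhds).prodMk_nhds ?_
      refine tendsto_comp_of_locally_uniform_limit_within (F := fun z : ℕ × ℝ => up z.1)
        hd.continuousAt.continuousWithinAt tendsto_snd fun v hv =>
        ⟨Icc 0 T, self_mem_nhdsWithin, ?_⟩
      exact tendsto_fst.eventually (hlim v hv)
    · filter_upwards [tendsto_snd.eventually self_mem_nhdsWithin] with z hz using ⟨hz, mem_univ _⟩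
  have hGtend : Tendsto (fun z : ℕ × ℝ => G (z.2, up z.1 z.2)) (atTop ×ˢ 𝓝[Icc 0 T] t₀)
      (𝓝 (G (t₀, u t₀))) := (hGc (t₀, u t₀) ⟨ht₀', mem_univ _⟩).tendsto.comp htend
  have hderiv : HasDerivAt (fun t => ‖u t - y‖ ^ 2) (2 * inner ℝ (u t₀ - y) (deriv u t₀)) t₀ :=
    (hd.hasDerivAt.sub_const y).norm_sq
  have key : ∀ ε > 0, 2 * inner ℝ (u t₀ - y) (deriv u t₀) ≤ G (t₀, u t₀) + ε := by
    intro ε hε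
    obtain ⟨P, hP, S, hS, hPS⟩ := eventually_prod_iff.1
      (hGtend.eventually_le_const (lt_add_of_pos_right _ hε))
    refine le_of_eventually_sub_le hderiv ?_
    have hS' : ∀ᶠ r in 𝓝[≥] t₀, S r := by
      refine nhdsWithin_le_iff.2 ?_ hS
      exact mem_nhdsWithin_of_mem_nhds (Icc_mem_nhds ht₀.1 ht₀.2)
    obtain ⟨δ, hδ, hδS⟩ := (mem_nhdsGE_iff_exists_Ico_subset' ht₀.2).1 hS'
    filter_upwards [Ioo_mem_nhdsGT (lt_min hδ ht₀.2)] with t ht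
    have htT : t ≤ T := ht.2.le.trans (min_le_right _ _)
    have htδ : t < δ := ht.2.trans_le (min_le_left _ _)
    have hsub : Icc t₀ t ⊆ Icc 0 T := Icc_subset_Icc ht₀.1.le htT
    -- Replacing `a p (up p r)` by `η` in the derivative of `‖up p - y‖²` costs at most `‖η‖²/p`, by
    -- monotonicity at the resolvent point and Young's inequality. The rest is `G`, within `ε` of
    -- its value at `(t₀, u t₀)`.
    have hstep : ∀ᶠ p : ℕ in atTop, ‖up p t - y‖ ^ 2 - ‖up p t₀ - y‖ ^ 2 ≤
        (G (t₀, u t₀) + ε + (p : ℝ)⁻¹ * ‖η‖ ^ 2) * (t - t₀) := by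
      filter_upwards [hP, eventually_ge_atTop 1] with p hpP hp
      have hp' : (0 : ℝ) < (p : ℝ)⁻¹ := by positivity
      set k := G (t₀, u t₀) + ε + (p : ℝ)⁻¹ * ‖η‖ ^ 2 with hk
      have hanti := antitoneOn_Icc_of_hasDerivWithinAt_nonpos (a := t₀) (b := t)
        (g := fun r => ‖up p r - y‖ ^ 2 - k * r)
        (g' := fun r => 2 * inner ℝ (up p r - y) (b r (up p r) - a p (up p r)) - k)
        (fun r hr => by
          have h1 := ((((hup p hp).hasDerivWithinAt r (hsub hr)).mono hsub).sub_const y).norm_sq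
          have h2 := ((hasDerivAt_id r).const_mul k).hasDerivWithinAt (s := Icc t₀ t)
          simpa using! h1.sub h2)
        (fun r hr => by
          have h1 : G (r, up p r) ≤ G (t₀, u t₀) + ε :=
            hPS hpP (hδS ⟨hr.1, hr.2.trans_lt htδ⟩)
          have h2 := hA.monotone (hA.mem hp (up p r)) hη
          have h3 : up p r - (p : ℝ)⁻¹ • a p (up p r) - y =
            (up p r - y) - (p : ℝ)⁻¹ • a p (up p r) := by abel
          rw [h3, inner_sub_right, inner_smul_right, inner_sub_left (a p (up p r)) η (a p (up p r)),
            real_inner_self_eq_norm_sq] at h2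
          have h4 : inner ℝ η (a p (up p r)) ≤ ‖a p (up p r)‖ ^ 2 + ‖η‖ ^ 2 / 2 := by
            have := real_inner_le_norm η (a p (up p r))
            nlinarith [sq_nonneg (‖a p (up p r)‖ - ‖η‖), sq_nonneg ‖a p (up p r)‖]
          have h5 := mul_le_mul_of_nonneg_left h4 hp'.le
          have h6 : b r (up p r) - a p (up p r) =
            (b r (up p r) - η) - (a p (up p r) - η) := by abel
          simp only [hG, Function.uncurry_apply_pair] at h1
          rw [h6, inner_sub_right, real_inner_comm (a p (up p r) - η)]
          simp only [hG, Function.uncurry_apply_pair] at hk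
          rw [hk]
          linarith)
        (left_mem_Icc.2 ht.1.le) (right_mem_Icc.2 ht.1.le) ht.1.le
      simp only at hanti
      linarith
    have hl1 : Tendsto (fun p => ‖up p t - y‖ ^ 2 - ‖up p t₀ - y‖ ^ 2) atTop
        (𝓝 (‖u t - y‖ ^ 2 - ‖u t₀ - y‖ ^ 2)) :=
      (((hlim.tendsto_at (hsub (right_mem_Icc.2 ht.1.le))).sub_const y).norm.pow 2).sub
        (((hlim.tendsto_at ht₀').sub_const y).norm.pow 2)
    have hl2 : Tendsto (fun p : ℕ => (G (t₀, u t₀) + ε + (p : ℝ)⁻¹ * ‖η‖ ^ 2) * (t - t₀)) atTop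
        (𝓝 ((G (t₀, u t₀) + ε) * (t - t₀))) := by
      have := (((tendsto_inv_atTop_nhds_zero_nat (𝕜 := ℝ)).mul_const (‖η‖ ^ 2)).const_add
        (G (t₀, u t₀) + ε)).mul_const (t - t₀)
      simpa using this
    exact le_of_tendsto_of_tendsto hl1 hl2 hstep
  have hfin := le_of_forall_pos_le_add key
  simp only [hG, Function.uncurry_apply_pair] at hfin
  have h1 : b t₀ (u t₀) - deriv u t₀ - η = (b t₀ (u t₀) - η) - deriv u t₀ := by abel
  rw [real_inner_comm, h1, inner_sub_right]
  linarith

/-- The solutions of the penalized equations converge uniformly to a strong solution of the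
inclusion, whose derivative is square integrable. -/
theorem exists_isStrongSolution [FiniteDimensional ℝ H] (hA : IsYosidaApproximation A a Φ)
    (hT : 0 ≤ T) (hbK : ∀ t ∈ Icc 0 T, LipschitzWith K (b t))
    (hb : ContinuousOn (Function.uncurry b) (Icc 0 T ×ˢ univ)) {C₀ : ℝ}
    (hΦ : ∀ p : ℕ, 1 ≤ p → Φ p u₀ ≤ C₀) {up : ℕ → ℝ → H}
    (hup : ∀ p : ℕ, 1 ≤ p → IsClassicalSolution (a p) b u₀ T (up p)) :
    ∃ u, IsStrongSolution A b u₀ T u ∧ MemLp (deriv u) 2 (volume.restrict (Ioo 0 T)) ∧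
      TendstoUniformlyOn up u atTop (Icc 0 T) := by
  have : CompleteSpace H := FiniteDimensional.complete ℝ H
  obtain ⟨M, hM⟩ := hA.exists_energy_bound hT hbK hb hΦ
  choose! V V' hVd hV0 hVT hV' using fun p (hp : 1 ≤ p) => hM p hp (up p) (hup p hp)
  have hVmono : ∀ p, 1 ≤ p → MonotoneOn (V p) (Icc 0 T) := fun p hp =>
    monotoneOn_Icc_of_hasDerivWithinAt_nonneg (hVd p hp) fun t ht =>
      (sq_nonneg _).trans (hV' p hp t ht).1
  have hVnonneg : ∀ p, 1 ≤ p → ∀ t ∈ Icc 0 T, 0 ≤ V p t := fun p hp t ht =>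
    hV0 p hp ▸ hVmono p hp (left_mem_Icc.2 hT) ht ht.1
  have hVle : ∀ p, 1 ≤ p → ∀ t ∈ Icc 0 T, V p t ≤ M := fun p hp t ht =>
    (hVmono p hp ht (right_mem_Icc.2 hT) ht.2).trans (hVT p hp)
  have hdist : ∀ p, 1 ≤ p → ∀ s ∈ Icc 0 T, ∀ t ∈ Icc 0 T,
      dist (up p s) (up p t) ^ 2 ≤ dist s t * dist (V p s) (V p t) := fun p hp s hs t ht =>
    dist_sq_le_mul_dist (hup p hp).hasDerivWithinAt (hVd p hp)
      (fun r hr => (hV' p hp r hr).2) hs ht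
  have hM0 : 0 ≤ M := (hVnonneg 1 le_rfl T (right_mem_Icc.2 hT)).trans (hVT 1 le_rfl)
  have hcauchy : UniformCauchySeqOn up atTop (Icc 0 T) := by
    rw [Metric.uniformCauchySeqOn_iff]
    intro ε hε
    -- Both energies are at most `M` and both inverse parameters at most `1/N`, whence `(1/N +
    -- 1/N)(M + M) = 4M/N`.
    set B := Real.exp (2 * K * T) * (4 * M) with hB
    have hlim : Tendsto (fun p : ℕ => (p : ℝ)⁻¹ * B) atTop (𝓝 0) := by
      simpa using (tendsto_inv_atTop_nhds_zero_nat (𝕜 := ℝ)).mul_const B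
    obtain ⟨N, hN, hN1⟩ := ((hlim.eventually_lt_const (by positivity : 0 < ε ^ 2)).and
      (eventually_ge_atTop 1)).exists
    refine ⟨N, fun p hp q hq t ht => ?_⟩
    have hp1 : 1 ≤ p := hN1.trans hp
    have hq1 : 1 ≤ q := hN1.trans hq
    have h1 := hA.norm_sub_sq_le hbK hp1 hq1 (hup p hp1) (hup q hq1)
      (hVd p hp1) (fun s hs => (hV' p hp1 s hs).1) (hV0 p hp1)
      (hVd q hq1) (fun s hs => (hV' q hq1 s hs).1) (hV0 q hq1) ht
    have hNpos : (0 : ℝ) < N := by positivity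
    have hpN : (p : ℝ)⁻¹ ≤ (N : ℝ)⁻¹ := by gcongr
    have hqN : (q : ℝ)⁻¹ ≤ (N : ℝ)⁻¹ := by gcongr
    have h2 : ‖up p t - up q t‖ ^ 2 ≤ (N : ℝ)⁻¹ * B := by
      have htT : t ≤ T := ht.2
      calc _ ≤ _ := h1
        _ ≤ Real.exp (2 * K * T) * (((N : ℝ)⁻¹ + (N : ℝ)⁻¹) * (M + M)) := by
          have := hVnonneg p hp1 t ht
          have := hVnonneg q hq1 t ht
          have := hVle p hp1 t ht
          have := hVle q hq1 t ht
          gcongr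
        _ = (N : ℝ)⁻¹ * B := by rw [hB]; ring
    rw [dist_eq_norm]
    exact lt_of_pow_lt_pow_left₀ 2 hε.le (h2.trans_lt hN)
  have hptw : ∀ t ∈ Icc 0 T, ∃ x, Tendsto (fun p => up p t) atTop (𝓝 x) := fun t ht =>
    cauchySeq_tendsto_of_complete (hcauchy.cauchySeq ht)
  choose! u hu using hptw
  have hlim := hcauchy.tendstoUniformlyOn_of_tendsto hu
  have hac : AbsolutelyContinuousOnInterval u 0 T := by
    refine absolutelyContinuousOnInterval_of_tendsto (M := M) (V := V) hT hu ?_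
    filter_upwards [eventually_ge_atTop 1] with p hp
    exact ⟨hVmono p hp, fun t ht => (hVd p hp t ht).continuousWithinAt,
      by rw [hV0 p hp, sub_zero]; exact hVT p hp, hdist p hp⟩
  -- Absolute continuity gives bounded variation, hence differentiability almost everywhere in
  -- finite dimension.
  have hdiff : ∀ᵐ t : ℝ, t ∈ Ioo 0 T → DifferentiableAt ℝ u t := by
    filter_upwards [hac.boundedVariationOn.ae_differentiableAt_of_mem_uIcc] with t h ht
    exact h (by rw [uIcc_of_le hT]; exact Ioo_subset_Icc_self ht)
  refine ⟨u, ⟨hac, ?_, ?_⟩, ?_, hlim⟩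
  · refine tendsto_nhds_unique (hu 0 (left_mem_Icc.2 hT)) (tendsto_const_nhds.congr' ?_)
    filter_upwards [eventually_ge_atTop 1] with p hp using (hup p hp).init.symm
  · filter_upwards [hdiff] with t h ht
    exact ⟨h ht, hA.sub_deriv_mem_of_tendstoUniformlyOn hb hup hlim ht (h ht)⟩
  · have hbdd : ∀ t ∈ Icc 0 T, IsBoundedUnder (· ≤ ·) atTop (fun p => V p t) ∧
        IsBoundedUnder (· ≥ ·) atTop (fun p => V p t) := fun t ht =>
      ⟨isBoundedUnder_of_eventually_le (a := M)
        ((eventually_ge_atTop 1).mono fun p hp => hVle p hp t ht),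
       isBoundedUnder_of_eventually_ge (a := 0)
        ((eventually_ge_atTop 1).mono fun p hp => hVnonneg p hp t ht)⟩
    -- The `V p` need not converge, but their upper limit is monotone and inherits the increment
    -- inequality, because the term in `up p` does converge.
    have hmono : MonotoneOn (fun t => limsup (fun p => V p t) atTop) (Icc 0 T) :=
      fun s hs t ht hst => limsup_le_limsup
        ((eventually_ge_atTop 1).mono fun p hp => hVmono p hp hs ht hst)
        (hbdd s hs).2.isCoboundedUnder_le (hbdd t ht).1
    refine memLp_deriv_of_dist_sq_le hT hmono hdiff fun s hs t ht hst => ?_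
    have hpos : 0 < t - s := sub_pos.2 hst
    have hd : Tendsto (fun p => (t - s)⁻¹ * ‖up p t - up p s‖ ^ 2) atTop
        (𝓝 ((t - s)⁻¹ * ‖u t - u s‖ ^ 2)) :=
      (((hu t ht).sub (hu s hs)).norm.pow 2).const_mul _
    have h1 := le_limsup_add (hbdd s hs).1 (hbdd s hs).2.isCoboundedUnder_le
      hd.isBoundedUnder_le hd.isBoundedUnder_ge
    rw [hd.liminf_eq] at h1
    have hle : ∀ᶠ p in atTop, ((fun p => V p s) +
        fun p => (t - s)⁻¹ * ‖up p t - up p s‖ ^ 2) p ≤ V p t := by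
      filter_upwards [eventually_ge_atTop 1] with p hp
      have h2 := hdist p hp s hs t ht
      rw [dist_comm, dist_eq_norm, dist_comm s, dist_comm (V p s), Real.dist_eq, Real.dist_eq,
        abs_of_pos hpos, abs_of_nonneg (sub_nonneg.2 (hVmono p hp hs ht hst.le)),
        ← inv_mul_le_iff₀ hpos] at h2
      simp only [Pi.add_apply]
      linarith
    have h3 := limsup_le_limsup hle
      (isBoundedUnder_of_eventually_ge (a := 0) ((eventually_ge_atTop 1).mono fun p hp =>
        add_nonneg (hVnonneg p hp s hs) (by positivity))).isCoboundedUnder_le (hbdd t ht).1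
    rw [← inv_mul_le_iff₀ hpos]
    linarith

end IsYosidaApproximation

/-- Only these properties of the convex function enter the evolution problem, and they are stable
under products. -/
theorem IsProperConvexLSC.isYosidaApproximation {q : ℕ} {F : E q → EReal}
    (hF : IsProperConvexLSC F) :
    IsYosidaApproximation (subdifferential F) (yosida F)
      (fun p x => (moreauYosida F p x).toReal) where
  monotone := subdifferential_monotone hF.ne_bot
  mem hp x := prox_eq_sub (F := F) hp x ▸ hF.yosida_mem_subdifferential hp x
  add_inner_le hp x y := hF.moreauYosida_add_inner_le hp x y
  le_add_inner hp x y := hF.moreauYosida_le_add_inner hp x y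
  one_le hp x := hF.moreauYosida_one_le hp x

/-! ### Reduction of the coupled system to one inclusion on the ℓ² product. -/

section Pair

variable {H₁ H₂ : Type*} [NormedAddCommGroup H₁] [NormedAddCommGroup H₂]
  {bx : H₁ × H₂ → H₁} {bz : H₁ × H₂ → H₂} {f : ℝ → H₁} {T : ℝ}

/-- The right-hand side of the coupled system on the product Hilbert space. -/
def coupledField (bx : H₁ × H₂ → H₁) (bz : H₁ × H₂ → H₂) (f : ℝ → H₁) (t : ℝ)
    (u : WithLp 2 (H₁ × H₂)) : WithLp 2 (H₁ × H₂) :=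
  WithLp.toLp 2 (bx u.ofLp + f t, bz u.ofLp)

/-- The product of two set-valued operators. -/
def prodOperator (A₁ : H₁ → Set H₁) (A₂ : H₂ → Set H₂) (u : WithLp 2 (H₁ × H₂)) :
    Set (WithLp 2 (H₁ × H₂)) :=
  {ξ | ξ.fst ∈ A₁ u.fst ∧ ξ.snd ∈ A₂ u.snd}

/-- The product of two families of maps. -/
def prodFamily (a₁ : ℕ → H₁ → H₁) (a₂ : ℕ → H₂ → H₂) (p : ℕ) (u : WithLp 2 (H₁ × H₂)) :
    WithLp 2 (H₁ × H₂) :=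
  WithLp.toLp 2 (a₁ p u.fst, a₂ p u.snd)

theorem toLp_eq_toLp_iff {α β : Type*} {x x' : α} {z z' : β} :
    (WithLp.toLp 2 (x, z) : WithLp 2 (α × β)) = WithLp.toLp 2 (x', z') ↔
      x = x' ∧ z = z' := by
  rw [(WithLp.toLp_injective 2).eq_iff, Prod.mk.injEq]

theorem exists_lipschitzWith_coupledField (hbx : ∃ K, LipschitzWith K bx)
    (hbz : ∃ K, LipschitzWith K bz) (f : ℝ → H₁) :
    ∃ K, ∀ t, LipschitzWith K (coupledField bx bz f t) := by
  obtain ⟨K₁, h₁⟩ := hbx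
  obtain ⟨K₂, h₂⟩ := hbz
  have hof := WithLp.prod_lipschitzWith_ofLp 2 H₁ H₂
  exact ⟨_, fun t => (WithLp.prod_lipschitzWith_toLp 2 H₁ H₂).comp
    (((h₁.comp hof).add (LipschitzWith.const (f t))).prodMk (h₂.comp hof))⟩

theorem continuousOn_coupledField (hbx : Continuous bx) (hbz : Continuous bz)
    (hf : ContinuousOn f (Icc 0 T)) :
    ContinuousOn (Function.uncurry (coupledField bx bz f)) (Icc 0 T ×ˢ univ) := by
  have hof : Continuous fun u : ℝ × WithLp 2 (H₁ × H₂) => u.2.ofLp :=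
    (WithLp.prod_continuous_ofLp 2 H₁ H₂).comp continuous_snd
  have h1 : ContinuousOn (fun u : ℝ × WithLp 2 (H₁ × H₂) => bx u.2.ofLp + f u.1)
      (Icc 0 T ×ˢ univ) :=
    (hbx.comp hof).continuousOn.add (hf.comp continuousOn_fst fun u hu => hu.1)
  have h2 : ContinuousOn (fun u : ℝ × WithLp 2 (H₁ × H₂) => bz u.2.ofLp) (Icc 0 T ×ˢ univ) :=
    (hbz.comp hof).continuousOn
  exact (WithLp.prod_continuous_toLp 2 H₁ H₂).comp_continuousOn (h1.prodMk h2)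

theorem dist_toLp_le (x x' : H₁) (z z' : H₂) :
    dist (WithLp.toLp 2 (x, z) : WithLp 2 (H₁ × H₂)) (WithLp.toLp 2 (x', z')) ≤
      dist x x' + dist z z' := by
  rw [dist_eq_norm, dist_eq_norm, dist_eq_norm]
  refine le_of_sq_le_sq ?_ (by positivity)
  rw [WithLp.prod_norm_sq_eq_of_L2]
  simp only [WithLp.sub_fst, WithLp.sub_snd, WithLp.toLp_fst, WithLp.toLp_snd]
  nlinarith [mul_nonneg (norm_nonneg (x - x')) (norm_nonneg (z - z'))]

variable [InnerProductSpace ℝ H₁] [InnerProductSpace ℝ H₂]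

theorem hasDerivWithinAt_toLp_iff {x x' : ℝ → H₁} {z z' : ℝ → H₂} {s : Set ℝ} {t : ℝ} :
    HasDerivWithinAt (fun r => (WithLp.toLp 2 (x r, z r) : WithLp 2 (H₁ × H₂)))
      (WithLp.toLp 2 (x' t, z' t)) s t ↔
      HasDerivWithinAt x (x' t) s t ∧ HasDerivWithinAt z (z' t) s t := by
  constructor
  · intro h
    exact ⟨(WithLp.fstL 2 ℝ H₁ H₂).hasFDerivAt.comp_hasDerivWithinAt t h,
      (WithLp.sndL 2 ℝ H₁ H₂).hasFDerivAt.comp_hasDerivWithinAt t h⟩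
  · rintro ⟨h₁, h₂⟩
    exact (WithLp.prodContinuousLinearEquiv 2 ℝ H₁ H₂).symm.toContinuousLinearMap.hasFDerivAt
      |>.comp_hasDerivWithinAt t (h₁.prodMk h₂)

theorem differentiableAt_toLp_iff {x : ℝ → H₁} {z : ℝ → H₂} {t : ℝ} :
    DifferentiableAt ℝ (fun r => (WithLp.toLp 2 (x r, z r) : WithLp 2 (H₁ × H₂))) t ↔
      DifferentiableAt ℝ x t ∧ DifferentiableAt ℝ z t := by
  constructor
  · intro h
    exact ⟨((WithLp.fstL 2 ℝ H₁ H₂).differentiableAt.comp t h :),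
      ((WithLp.sndL 2 ℝ H₁ H₂).differentiableAt.comp t h :)⟩
  · rintro ⟨h₁, h₂⟩
    exact (WithLp.prodContinuousLinearEquiv 2 ℝ H₁ H₂).symm.toContinuousLinearMap.differentiableAt
      |>.comp t (h₁.prodMk h₂)

theorem deriv_toLp {x : ℝ → H₁} {z : ℝ → H₂} {t : ℝ} (hx : DifferentiableAt ℝ x t)
    (hz : DifferentiableAt ℝ z t) :
    deriv (fun r => (WithLp.toLp 2 (x r, z r) : WithLp 2 (H₁ × H₂))) t =
      WithLp.toLp 2 (deriv x t, deriv z t) := by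
  have h := hasDerivWithinAt_toLp_iff (x' := deriv x) (z' := deriv z) (s := univ) (t := t)
    |>.2 ⟨hx.hasDerivAt.hasDerivWithinAt, hz.hasDerivAt.hasDerivWithinAt⟩
  exact (hasDerivWithinAt_univ.1 h).deriv

variable {A₁ : H₁ → Set H₁} {a₁ : ℕ → H₁ → H₁} {Φ₁ : ℕ → H₁ → ℝ}
  {A₂ : H₂ → Set H₂} {a₂ : ℕ → H₂ → H₂} {Φ₂ : ℕ → H₂ → ℝ}
  {x₀ : H₁} {z₀ : H₂}

/-- The product of two operators with Yosida approximations. -/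
theorem IsYosidaApproximation.prod
    (h₁ : IsYosidaApproximation A₁ a₁ Φ₁) (h₂ : IsYosidaApproximation A₂ a₂ Φ₂) :
    IsYosidaApproximation (H := WithLp 2 (H₁ × H₂))
      (prodOperator A₁ A₂) (prodFamily a₁ a₂)
      (fun p u => Φ₁ p u.fst + Φ₂ p u.snd) where
  monotone hξ hη := by
    rw [WithLp.prod_inner_apply]
    exact add_nonneg (h₁.monotone hξ.1 hη.1) (h₂.monotone hξ.2 hη.2)
  mem hp u := ⟨h₁.mem hp u.fst, h₂.mem hp u.snd⟩
  add_inner_le hp u v := by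
    rw [WithLp.prod_inner_apply]
    have := h₁.add_inner_le hp u.fst v.fst
    have := h₂.add_inner_le hp u.snd v.snd
    simp only [WithLp.ofLp_sub, Prod.fst_sub, Prod.snd_sub]
    simp only [WithLp.ofLp_fst, WithLp.ofLp_snd, prodFamily]
    linarith
  le_add_inner hp u v := by
    rw [WithLp.prod_inner_apply, WithLp.prod_norm_sq_eq_of_L2]
    have := h₁.le_add_inner hp u.fst v.fst
    have := h₂.le_add_inner hp u.snd v.snd
    simp only [WithLp.ofLp_sub, Prod.fst_sub, Prod.snd_sub, WithLp.sub_fst, WithLp.sub_snd]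
    simp only [WithLp.ofLp_fst, WithLp.ofLp_snd, prodFamily]
    linarith
  one_le hp u := add_le_add (h₁.one_le hp u.fst) (h₂.one_le hp u.snd)

/-- Freezing the other component as a time-dependent datum expresses the coupling through the
single-equation predicate. -/
theorem isClassicalSolution_toLp_iff {p : ℕ} {x : ℝ → H₁} {z : ℝ → H₂} :
    IsClassicalSolution (prodFamily a₁ a₂ p) (coupledField bx bz f) (WithLp.toLp 2 (x₀, z₀)) T
      (fun t => WithLp.toLp 2 (x t, z t)) ↔
      IsClassicalSolution (a₁ p) (fun t ξ => bx (ξ, z t) + f t) x₀ T x ∧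
        IsClassicalSolution (a₂ p) (fun t ζ => bz (x t, ζ)) z₀ T z := by
  have hd : ∀ t, HasDerivWithinAt
      (fun t => (WithLp.toLp 2 (x t, z t) : WithLp 2 (H₁ × H₂)))
      (coupledField bx bz f t (WithLp.toLp 2 (x t, z t)) -
        prodFamily a₁ a₂ p (WithLp.toLp 2 (x t, z t))) (Icc 0 T) t ↔
      HasDerivWithinAt x (bx (x t, z t) + f t - a₁ p (x t)) (Icc 0 T) t ∧
      HasDerivWithinAt z (bz (x t, z t) - a₂ p (z t)) (Icc 0 T) t := fun t =>
    hasDerivWithinAt_toLp_iff (x' := fun t => bx (x t, z t) + f t - a₁ p (x t))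
      (z' := fun t => bz (x t, z t) - a₂ p (z t))
  constructor
  · rintro ⟨h0, h⟩
    obtain ⟨hx, hz⟩ := toLp_eq_toLp_iff.1 h0
    exact ⟨⟨hx, fun t ht => ((hd t).1 (h t ht)).1⟩, ⟨hz, fun t ht => ((hd t).1 (h t ht)).2⟩⟩
  · rintro ⟨⟨hx, h1⟩, ⟨hz, h2⟩⟩
    exact ⟨toLp_eq_toLp_iff.2 ⟨hx, hz⟩, fun t ht => (hd t).2 ⟨h1 t ht, h2 t ht⟩⟩

theorem isStrongSolution_toLp_iff {x : ℝ → H₁} {z : ℝ → H₂} :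
    IsStrongSolution (prodOperator A₁ A₂) (coupledField bx bz f) (WithLp.toLp 2 (x₀, z₀)) T
      (fun t => WithLp.toLp 2 (x t, z t)) ↔
      IsStrongSolution A₁ (fun t ξ => bx (ξ, z t) + f t) x₀ T x ∧
        IsStrongSolution A₂ (fun t ζ => bz (x t, ζ)) z₀ T z := by
  have hmem : ∀ t, DifferentiableAt ℝ x t → DifferentiableAt ℝ z t →
      (coupledField bx bz f t (WithLp.toLp 2 (x t, z t)) -
        deriv (fun t => (WithLp.toLp 2 (x t, z t) : WithLp 2 (H₁ × H₂))) t ∈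
          prodOperator A₁ A₂ (WithLp.toLp 2 (x t, z t)) ↔
      bx (x t, z t) + f t - deriv x t ∈ A₁ (x t) ∧ bz (x t, z t) - deriv z t ∈ A₂ (z t)) :=
    fun t hx hz => by
      rw [deriv_toLp hx hz]
      exact Iff.rfl
  constructor
  · rintro ⟨hac, h0, h⟩
    obtain ⟨hx, hz⟩ := toLp_eq_toLp_iff.1 h0
    have h' : ∀ᵐ t, t ∈ Ioo 0 T → (DifferentiableAt ℝ x t ∧ DifferentiableAt ℝ z t) ∧
        bx (x t, z t) + f t - deriv x t ∈ A₁ (x t) ∧ bz (x t, z t) - deriv z t ∈ A₂ (z t) := by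
      filter_upwards [h] with t h ht
      obtain ⟨hdx, hdz⟩ := differentiableAt_toLp_iff.1 (h ht).1
      exact ⟨⟨hdx, hdz⟩, (hmem t hdx hdz).1 (h ht).2⟩
    exact ⟨⟨absolutelyContinuousOnInterval_of_dist_le hac fun s t =>
        WithLp.dist_fst_le (p := 2) (WithLp.toLp 2 (x s, z s)) (WithLp.toLp 2 (x t, z t)), hx,
        h'.mono fun t h ht => ⟨(h ht).1.1, (h ht).2.1⟩⟩,
      ⟨absolutelyContinuousOnInterval_of_dist_le hac fun s t =>
        WithLp.dist_snd_le (p := 2) (WithLp.toLp 2 (x s, z s)) (WithLp.toLp 2 (x t, z t)), hz,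
        h'.mono fun t h ht => ⟨(h ht).1.2, (h ht).2.2⟩⟩⟩
  · rintro ⟨⟨hacx, hx, h1⟩, ⟨hacz, hz, h2⟩⟩
    refine ⟨absolutelyContinuousOnInterval_of_dist_le_add hacx hacz fun s t => dist_toLp_le _ _ _ _,
      toLp_eq_toLp_iff.2 ⟨hx, hz⟩, ?_⟩
    filter_upwards [h1, h2] with t h1 h2 ht
    obtain ⟨hdx, hix⟩ := h1 ht
    obtain ⟨hdz, hiz⟩ := h2 ht
    exact ⟨differentiableAt_toLp_iff.2 ⟨hdx, hdz⟩, (hmem t hdx hdz).2 ⟨hix, hiz⟩⟩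

/-- Well-posedness of a coupled system of two evolution inclusions, and convergence of its
Yosida approximations. -/
theorem coupled_wellPosed [FiniteDimensional ℝ H₁] [FiniteDimensional ℝ H₂]
    (h₁ : IsYosidaApproximation A₁ a₁ Φ₁) (h₂ : IsYosidaApproximation A₂ a₂ Φ₂) (hT : 0 ≤ T)
    (hbx : ∃ K, LipschitzWith K bx) (hbz : ∃ K, LipschitzWith K bz)
    (hf : ContinuousOn f (Icc 0 T)) (hΦ₁ : ∃ C, ∀ p : ℕ, 1 ≤ p → Φ₁ p x₀ ≤ C)
    (hΦ₂ : ∃ C, ∀ p : ℕ, 1 ≤ p → Φ₂ p z₀ ≤ C) :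
    ∃ (x : ℝ → H₁) (z : ℝ → H₂),
      (IsStrongSolution A₁ (fun t ξ => bx (ξ, z t) + f t) x₀ T x ∧
        IsStrongSolution A₂ (fun t ζ => bz (x t, ζ)) z₀ T z ∧
        MemLp (deriv x) 2 (volume.restrict (Ioo 0 T)) ∧
        MemLp (deriv z) 2 (volume.restrict (Ioo 0 T))) ∧
      (∀ (y : ℝ → H₁) (w : ℝ → H₂),
        IsStrongSolution A₁ (fun t ξ => bx (ξ, w t) + f t) x₀ T y →
        IsStrongSolution A₂ (fun t ζ => bz (y t, ζ)) z₀ T w →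
          EqOn y x (Icc 0 T) ∧ EqOn w z (Icc 0 T)) ∧
      ∃ (xp : ℕ → ℝ → H₁) (zp : ℕ → ℝ → H₂),
        (∀ p : ℕ, 1 ≤ p →
          (IsClassicalSolution (a₁ p) (fun t ξ => bx (ξ, zp p t) + f t) x₀ T (xp p) ∧
            IsClassicalSolution (a₂ p) (fun t ζ => bz (xp p t, ζ)) z₀ T (zp p)) ∧
          ∀ (y : ℝ → H₁) (w : ℝ → H₂),
            IsClassicalSolution (a₁ p) (fun t ξ => bx (ξ, w t) + f t) x₀ T y →
            IsClassicalSolution (a₂ p) (fun t ζ => bz (y t, ζ)) z₀ T w →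
              EqOn y (xp p) (Icc 0 T) ∧ EqOn w (zp p) (Icc 0 T)) ∧
        TendstoUniformlyOn xp x atTop (Icc 0 T) ∧ TendstoUniformlyOn zp z atTop (Icc 0 T) := by
  have hc₁ : CompleteSpace H₁ := FiniteDimensional.complete ℝ H₁
  have hc₂ : CompleteSpace H₂ := FiniteDimensional.complete ℝ H₂
  have hfin : FiniteDimensional ℝ (WithLp 2 (H₁ × H₂)) :=
    (WithLp.linearEquiv 2 ℝ (H₁ × H₂)).symm.finiteDimensional
  obtain ⟨K, hK⟩ := exists_lipschitzWith_coupledField hbx hbz f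
  have hb := continuousOn_coupledField hbx.choose_spec.continuous
    hbz.choose_spec.continuous hf
  have hA := h₁.prod h₂
  obtain ⟨C₁, hC₁⟩ := hΦ₁
  obtain ⟨C₂, hC₂⟩ := hΦ₂
  have hpen : ∀ p : ℕ, 1 ≤ p → ∃ u, IsClassicalSolution (prodFamily a₁ a₂ p)
      (coupledField bx bz f) (WithLp.toLp 2 (x₀, z₀)) T u := fun p hp =>
    hA.exists_isClassicalSolution hT (fun t _ => hK t) hb _ hp
  choose! up hup using hpen
  obtain ⟨u, hu, hu2, hlim⟩ := hA.exists_isStrongSolution (u₀ := WithLp.toLp 2 (x₀, z₀)) hT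
    (fun t _ => hK t) hb
    (C₀ := C₁ + C₂) (fun p hp => add_le_add (hC₁ p hp) (hC₂ p hp)) hup
  obtain ⟨hx, hz⟩ := isStrongSolution_toLp_iff
    (x := fun t => (u t).fst) (z := fun t => (u t).snd) |>.1 hu
  refine ⟨fun t => (u t).fst, fun t => (u t).snd, ⟨hx, hz, ?_, ?_⟩, fun y w hy hw => ?_,
    fun p t => (up p t).fst, fun p t => (up p t).snd, fun p hp => ⟨?_, fun y w hy hw => ?_⟩, ?_, ?_⟩
  · refine hu2.mono (aestronglyMeasurable_deriv _ _) ?_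
    rw [ae_restrict_iff' measurableSet_Ioo]
    filter_upwards [hu.incl] with t h ht
    have hd : deriv (fun t => (u t).fst) t = (deriv u t).fst :=
      ((WithLp.fstL 2 ℝ H₁ H₂).hasFDerivAt.comp_hasDerivAt t (h ht).1.hasDerivAt).deriv
    rw [hd]
    exact WithLp.norm_fst_le H₁ _
  · refine hu2.mono (aestronglyMeasurable_deriv _ _) ?_
    rw [ae_restrict_iff' measurableSet_Ioo]
    filter_upwards [hu.incl] with t h ht
    have hd : deriv (fun t => (u t).snd) t = (deriv u t).snd :=
      ((WithLp.sndL 2 ℝ H₁ H₂).hasFDerivAt.comp_hasDerivAt t (h ht).1.hasDerivAt).deriv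
    rw [hd]
    exact WithLp.norm_snd_le H₁ _
  · have h := hA.eqOn_of_isStrongSolution (fun t _ => hK t)
      (isStrongSolution_toLp_iff.2 ⟨hy, hw⟩) hu
    exact ⟨fun t ht => congrArg WithLp.fst (h ht), fun t ht => congrArg WithLp.snd (h ht)⟩
  · exact isClassicalSolution_toLp_iff
      (x := fun t => (up p t).fst) (z := fun t => (up p t).snd) |>.1 (hup p hp)
  · have h := hA.eqOn_of_isClassicalSolution (fun t _ => hK t) hp
      (isClassicalSolution_toLp_iff.2 ⟨hy, hw⟩) (hup p hp)
    exact ⟨fun t ht => congrArg WithLp.fst (h ht), fun t ht => congrArg WithLp.snd (h ht)⟩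
  · rw [Metric.tendstoUniformlyOn_iff] at hlim ⊢
    intro ε hε
    filter_upwards [hlim ε hε] with p h t ht
    exact (WithLp.dist_fst_le _ _).trans_lt (h t ht)
  · rw [Metric.tendstoUniformlyOn_iff] at hlim ⊢
    intro ε hε
    filter_upwards [hlim ε hε] with p h t ht
    exact (WithLp.dist_snd_le _ _).trans_lt (h t ht)

end Pair

/-! ### Application to the subdifferentials of `φ` and `ψ`. -/

section System

variable {n m : ℕ} {φ : E n → EReal} {ψ : E m → EReal} {bx : E n × E m → E n}
  {bz : E n × E m → E m} {f : ℝ → E n} {x₀ : E n} {z₀ : E m} {T : ℝ}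

theorem isSolution_iff {x : ℝ → E n} {z : ℝ → E m} :
    IsSolution φ ψ bx bz f x₀ z₀ T x z ↔
      IsStrongSolution (subdifferential φ) (fun t ξ => bx (ξ, z t) + f t) x₀ T x ∧
        IsStrongSolution (subdifferential ψ) (fun t ζ => bz (x t, ζ)) z₀ T z :=
  ⟨fun h => ⟨⟨h.absCont_x, h.init_x, h.incl_x⟩, ⟨h.absCont_z, h.init_z, h.incl_z⟩⟩,
    fun h => ⟨h.1.absCont, h.2.absCont, h.1.init, h.2.init, h.1.incl, h.2.incl⟩⟩

theorem isPenalizedSolution_iff (hφ : IsProperConvexLSC φ) (hψ : IsProperConvexLSC ψ)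
    {p : ℕ} (hp : 1 ≤ p) {x : ℝ → E n} {z : ℝ → E m} :
    IsPenalizedSolution φ ψ bx bz f x₀ z₀ T p x z ↔
      IsClassicalSolution (yosida φ p) (fun t ξ => bx (ξ, z t) + f t) x₀ T x ∧
        IsClassicalSolution (yosida ψ p) (fun t ζ => bz (x t, ζ)) z₀ T z := by
  constructor
  · intro h
    refine ⟨⟨h.init_x, fun t ht => ?_⟩, ⟨h.init_z, fun t ht => ?_⟩⟩
    · rw [← hφ.gradMoreauYosida_eq hp]
      exact h.eq_x t ht
    · rw [← hψ.gradMoreauYosida_eq hp]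
      exact h.eq_z t ht
  · intro h
    refine ⟨h.1.init, h.2.init, fun t ht => ?_, fun t ht => ?_⟩
    · rw [hφ.gradMoreauYosida_eq hp]
      exact h.1.hasDerivWithinAt t ht
    · rw [hψ.gradMoreauYosida_eq hp]
      exact h.2.hasDerivWithinAt t ht

end System

end MultivaluedODE

theorem mainTheorem7
    {n m : ℕ} (hn : 1 ≤ n) (hm : 1 ≤ m) {T : ℝ} (hT : 0 < T)
    (φ : MultivaluedODE.E n → EReal) (ψ : MultivaluedODE.E m → EReal)
    (hφ : MultivaluedODE.IsProperConvexLSC φ) (hψ : MultivaluedODE.IsProperConvexLSC ψ)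
    (bx : MultivaluedODE.E n × MultivaluedODE.E m → MultivaluedODE.E n)
    (bz : MultivaluedODE.E n × MultivaluedODE.E m → MultivaluedODE.E m)
    (hbx : ∃ K, LipschitzWith K bx) (hbz : ∃ K, LipschitzWith K bz)
    (f : ℝ → MultivaluedODE.E n) (hf : ContinuousOn f (Icc 0 T))
    (x₀ : MultivaluedODE.E n) (z₀ : MultivaluedODE.E m)
    (hφ_grad : MultivaluedODE.UniformGradientBound φ)
    (hψ_init : (⨆ (p : ℕ) (_ : 1 ≤ p), MultivaluedODE.moreauYosida ψ p z₀) < ⊤) :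
    ∃ (x : ℝ → MultivaluedODE.E n) (z : ℝ → MultivaluedODE.E m),
      -- existence, with square integrable derivatives
      (MultivaluedODE.IsSolution φ ψ bx bz f x₀ z₀ T x z ∧
        MemLp (deriv x) 2 (volume.restrict (Ioo 0 T)) ∧
        MemLp (deriv z) 2 (volume.restrict (Ioo 0 T))) ∧
      -- uniqueness
      (∀ (y : ℝ → MultivaluedODE.E n) (w : ℝ → MultivaluedODE.E m),
        MultivaluedODE.IsSolution φ ψ bx bz f x₀ z₀ T y w →
          EqOn y x (Icc 0 T) ∧ EqOn w z (Icc 0 T)) ∧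
      -- well-posedness of the penalized systems and uniform convergence to the solution
      (∃ (xp : ℕ → ℝ → MultivaluedODE.E n) (zp : ℕ → ℝ → MultivaluedODE.E m),
        (∀ p : ℕ, 1 ≤ p →
          MultivaluedODE.IsPenalizedSolution φ ψ bx bz f x₀ z₀ T p (xp p) (zp p) ∧
          ∀ (y : ℝ → MultivaluedODE.E n) (w : ℝ → MultivaluedODE.E m),
            MultivaluedODE.IsPenalizedSolution φ ψ bx bz f x₀ z₀ T p y w →
              EqOn y (xp p) (Icc 0 T) ∧ EqOn w (zp p) (Icc 0 T)) ∧
        TendstoUniformlyOn xp x atTop (Icc 0 T) ∧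
        TendstoUniformlyOn zp z atTop (Icc 0 T)) := by
  obtain ⟨x, z, ⟨hx, hz, hx2, hz2⟩, huniq, xp, zp, hpen, hxp, hzp⟩ :=
    MultivaluedODE.coupled_wellPosed hφ.isYosidaApproximation hψ.isYosidaApproximation hT.le
      hbx hbz hf (hφ.exists_moreauYosida_le hφ_grad x₀)
      (hψ.exists_moreauYosida_le_of_iSup_lt_top hψ_init)
  refine ⟨x, z, ⟨MultivaluedODE.isSolution_iff.2 ⟨hx, hz⟩, hx2, hz2⟩, fun y w h => ?_, xp, zp,
    fun p hp => ⟨(MultivaluedODE.isPenalizedSolution_iff hφ hψ hp).2 (hpen p hp).1,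
      fun y w h => ?_⟩, hxp, hzp⟩
  · have h' := MultivaluedODE.isSolution_iff.1 h
    exact huniq y w h'.1 h'.2
  · have h' := (MultivaluedODE.isPenalizedSolution_iff hφ hψ hp).1 h
    exact (hpen p hp).2 y w h'.1 h'.2
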